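/- Let $k$ be a field, $A$ a $k$-algebra and $A^{e}=A\otimes_k A^{op}$ its enveloping algebra, so that left $A^{e}$-modules are the same as $A$-bimodules; write $\otimes$ for $\otimes_A$. Let $H$ be a left $A$-bialgebroid. Thus $H$ is a $k$-algebra with an algebra map $\eta\colon A^{e}\to H$, whose restrictions to $A$ and $A^{op}$ are denoted by $s$ and $t$. It is regarded as an $A$-bimodule by $a\cdot h\cdot b=s(a)t(b)h$, and it carries bimodule maps $\Delta\colon H\to H\otimes H$, $\Delta(h)=h_{(1)}\otimes h_{(2)}$, and $\epsilon\colon H\to A$ which form a comonoid in $A$-bimodules and satisfy, for $h,h'\in H$ and $a,b\in A$, $$\Delta(h\,s(a)t(b))=h_{(1)}s(a)\otimes h_{(2)}t(b),\qquad \epsilon(h\,s(a))=\epsilon(h\,t(a)),$$ $$\Delta(hh')=h_{(1)}h'_{(1)}\otimes h_{(2)}h'_{(2)},\qquad \Delta(1)=1\otimes 1,\qquad \epsilon(1)=1,\qquad \epsilon(hh')=\epsilon(h\,s(\epsilon(h')))=\epsilon(h\,t(\epsilon(h'))).$$ For an $A$-bimodule $M$ let $H\boxtimes M=H\otimes_{A^{e}}M$,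 where $H$ is a right $A^e$-module by $h\cdot x=h\,\eta(x)$; it is a bimodule by $a(h\boxtimes m)b=(s(a)t(b)h)\boxtimes m$. The functor $T=H\boxtimes-$ on $A$-bimodules is a bimonad: its multiplication and unit $\mu_M(h\boxtimes(h'\boxtimes m))=hh'\boxtimes m$, $m\mapsto 1\boxtimes m$ come from the algebra $H$, and its comonoidal structure is $T_2(M,N)(h\boxtimes(m\otimes n))=(h_{(1)}\boxtimes m)\otimes(h_{(2)}\boxtimes n)$, $T_0(h\boxtimes a)=\epsilon(h\,s(a))$. Hence $\underline H=H\boxtimes A$ is a coalgebra in $A$-bimodules; let $\pi\colon H\to\underline H$, $\pi(h)=h\boxtimes 1$. A left Hopf module over $T$ is an $A$-bimodule $M$ with an action $r\colon T(M)\to M$ of the monad $T$ and a coaction $\delta\colon M\to\underline H\otimes M$ of the coalgebra $\underline H$ in $A$-bimodules such that $\delta r=(\mathrm{id}\otimes r)\,H^{r}_{A,M}\,T(\delta)$, where $H^{r}_{A,M}=(\mu_A\otimes\mathrm{id})\,T_2(T(A),M)$. Morphisms are the bimodule maps which commute with actions and coactions. (1) These Hopf modules are $H$-modules with a compatible $\underline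 H$-coaction: the category of left Hopf modules over $T$ is equivalent, via $r(h\boxtimes m)=hm$ and with the same underlying bimodule and coaction, to the category of $H$-modules $M$ (bimodules through $\eta$) with an $\underline H$-coaction $\delta(m)=m_{(-1)}\otimes m_{(0)}$ satisfying $$\delta(hm)=h_{(1)}m_{(-1)}\otimes h_{(2)}m_{(0)}\in\underline H\otimes M\qquad(h\in H,\ m\in M),$$ and $H$-linear maps which commute with the coactions. Under this equivalence the free functor $M\mapsto(T(M),\mu_M,T_2(A,M))$ from $A$-bimodules to left Hopf modules over $T$ corresponds to the functor which sends $M$ to the free $H$-module $H\boxtimes M$ with the coaction $h\boxtimes m\mapsto\pi(h_{(1)})\otimes(h_{(2)}\boxtimes m)$. (2) Suppose that $H$ is a (Schauenburg) Hopf algebroid, that is, the maps $$H\otimes_{A^{op}}H\to H\otimes H,\quad h\otimes h'\mapsto h_{(1)}\otimes h_{(2)}h',\qquad\text{and}\qquad H\odot H\to H\otimes H,\quad h\odot h'\mapsto h_{(1)}h'\otimes h_{(2)},$$ are bijective, where $H\otimes_{A^{op}}H$ and $H\odot H$ are the quotients of $H\otimes_kH$ by the relations $h\,t(a)\otimes h'=h\otimes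 t(a)h'$ and $h\,s(a)\otimes h'=h\otimes s(a)h'$, respectively. If $H$ is faithfully flat as a right $A^{e}$-module, then the free Hopf module functor $M\mapsto H\boxtimes M$ is an equivalence from the category of $A$-bimodules to the category of left Hopf modules over $T$, and to the category of $H$-modules with a compatible $\underline H$-coaction described in (1). -/

import Mathlib

open CategoryTheory MulOpposite
open scoped TensorProduct

universe u

namespace HopfAlgebroids

/-! ## Balanced tensor products over a possibly noncommutative ring -/

section Balanced

variable {R M N P : Type*} [AddCommGroup M] [AddCommGroup N] [AddCommGroup P]

/-- The relations `m r ⊗ n = m ⊗ r n`, for an operation `ρ` of `R` on `M` (to be thought of as a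
right action) and an operation `σ` of `R` on `N` (to be thought of as a left action). -/
def balancedRel (ρ : R → M → M) (σ : R → N → N) : Submodule ℤ (M ⊗[ℤ] N) :=
  Submodule.span ℤ {z | ∃ r m n, z = ρ r m ⊗ₜ[ℤ] n - m ⊗ₜ[ℤ] σ r n}

/-- The tensor product of `M` and `N` balanced along the operations `ρ` and `σ` of `R`.
When `R` is an algebra over a field `k` whose two operations restrict to the scalar multiplications
of `k`, the relations contain those with `r ∈ k`, so that this is the quotient of `M ⊗[k] N` by the
same relations. -/
def Balanced (ρ : R → M → M) (σ : R → N → N) : Type _ :=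
  (M ⊗[ℤ] N) ⧸ balancedRel ρ σ

namespace Balanced

variable {ρ : R → M → M} {σ : R → N → N}

instance : AddCommGroup (Balanced ρ σ) :=
  inferInstanceAs (AddCommGroup ((M ⊗[ℤ] N) ⧸ balancedRel ρ σ))

variable (ρ σ) in
/-- The class of the pure tensor `m ⊗ n`. -/
def mk (m : M) (n : N) : Balanced ρ σ := Submodule.Quotient.mk (m ⊗ₜ[ℤ] n)

theorem mk_add_left (m m' : M) (n : N) : mk ρ σ (m + m') n = mk ρ σ m n + mk ρ σ m' n := by
  unfold mk; rw [TensorProduct.add_tmul]; rfl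

theorem mk_add_right (m : M) (n n' : N) : mk ρ σ m (n + n') = mk ρ σ m n + mk ρ σ m n' := by
  unfold mk; rw [TensorProduct.tmul_add]; rfl

theorem mk_bal (r : R) (m : M) (n : N) : mk ρ σ (ρ r m) n = mk ρ σ m (σ r n) :=
  (Submodule.Quotient.eq _).2 (Submodule.subset_span ⟨r, m, n, rfl⟩)

theorem induction {p : Balanced ρ σ → Prop} (h : ∀ m n, p (mk ρ σ m n))
    (ha : ∀ x y, p x → p y → p (x + y)) (x : Balanced ρ σ) : p x := by
  obtain ⟨y, rfl⟩ := Submodule.Quotient.mk_surjective _ x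
  induction y using TensorProduct.induction_on with
  | zero =>
    have := h 0 0
    unfold mk at this
    rwa [TensorProduct.zero_tmul] at this
  | tmul m n => exact h m n
  | add x y hx hy => exact ha _ _ hx hy

/-- The universal property of the balanced tensor product. -/
def lift (f : M →+ N →+ P) (hf : ∀ r m n, f (ρ r m) n = f m (σ r n)) : Balanced ρ σ →+ P :=
  ((balancedRel ρ σ).liftQ
    (TensorProduct.liftAddHom f (fun r m n => by
      rw [map_zsmul, map_zsmul]; rfl)).toIntLinearMap
    (by
      refine Submodule.span_le.2 ?_
      rintro _ ⟨r, m, n, rfl⟩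
      change _ = _
      rw [map_sub]
      exact sub_eq_zero.2 (hf r m n))).toAddMonoidHom

@[simp] theorem lift_mk (f : M →+ N →+ P) (hf : ∀ r m n, f (ρ r m) n = f m (σ r n)) (m : M)
    (n : N) : lift f hf (mk ρ σ m n) = f m n := rfl

theorem hom_ext {f g : Balanced ρ σ →+ P} (h : ∀ m n, f (mk ρ σ m n) = g (mk ρ σ m n)) :
    f = g := by
  ext x
  induction x using induction with
  | h m n => exact h m n
  | ha x y hx hy => rw [map_add, map_add, hx, hy]

/-- A biadditive map, as an element of `M →+ N →+ P`. -/
def mkHom₂ (f : M → N → P) (h₁ : ∀ m m' n, f (m + m') n = f m n + f m' n)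
    (h₂ : ∀ m n n', f m (n + n') = f m n + f m n') : M →+ N →+ P :=
  AddMonoidHom.mk' (fun m => AddMonoidHom.mk' (f m) (h₂ m)) (fun m m' => by ext n; exact h₁ m m' n)

@[simp] theorem mkHom₂_apply (f : M → N → P) (h₁ h₂) (m : M) (n : N) :
    mkHom₂ f h₁ h₂ m n = f m n := rfl

end Balanced

end Balanced

/-! ## Bimodules and their tensor product -/

/-- The enveloping algebra `A ⊗ Aᵒᵖ`. Its left modules are the `A`-bimodules. -/
abbrev Env (k A : Type*) [Field k] [Ring A] [Algebra k A] : Type _ := A ⊗[k] Aᵐᵒᵖ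

section Bimodules

variable (k : Type*) {A : Type*} [Field k] [Ring A] [Algebra k A]

/-- The element `a ⊗ 1` of the enveloping algebra: left multiplication by `a` on bimodules. -/
def el (a : A) : Env k A := a ⊗ₜ 1

/-- The element `1 ⊗ a` of the enveloping algebra: right multiplication by `a` on bimodules. -/
def er (a : A) : Env k A := 1 ⊗ₜ op a

theorem el_mul (a b : A) : el k (a * b) = el k a * el k b := by simp [el]

theorem er_mul (a b : A) : er k (a * b) = er k b * er k a := by simp [er]

theorem el_mul_er (a b : A) : el k a * er k b = er k b * el k a := by simp [el, er]

theorem el_add (a b : A) : el k (a + b) = el k a + el k b := by simp [el, TensorProduct.add_tmul]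

theorem er_add (a b : A) : er k (a + b) = er k a + er k b := by simp [er, TensorProduct.tmul_add]

theorem el_one : el k (1 : A) = 1 := rfl

theorem er_one : er k (1 : A) = 1 := rfl

theorem el_algebraMap (c : k) : el k (algebraMap k A c) = er k (algebraMap k A c) := by
  have : op (algebraMap k A c) = algebraMap k Aᵐᵒᵖ c := rfl
  rw [el, er, this, Algebra.algebraMap_eq_smul_one, Algebra.algebraMap_eq_smul_one,
    TensorProduct.smul_tmul]

theorem tmul_eq (a : A) (b : Aᵐᵒᵖ) : a ⊗ₜ[k] b = el k a * er k (unop b) := by simp [el, er]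

theorem env_induction {p : Env k A → Prop} (h : ∀ a b, p (el k a * er k b))
    (ha : ∀ x y, p x → p y → p (x + y)) (x : Env k A) : p x := by
  induction x using TensorProduct.induction_on with
  | zero => simpa [el] using h 0 0
  | tmul a b => rw [tmul_eq]; exact h _ _
  | add x y hx hy => exact ha _ _ hx hy

/-- `A` as a bimodule over itself. -/
instance regularBimodule : Module (Env k A) A := TensorProduct.Algebra.module

theorem el_smul (a c : A) : el k a • c = a * c := by
  change TensorProduct.Algebra.moduleAux _ _ = _
  simp [el, TensorProduct.Algebra.moduleAux_apply]

theorem er_smul (a c : A) : er k a • c = c * a := by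
  change TensorProduct.Algebra.moduleAux _ _ = _
  simp [er, TensorProduct.Algebra.moduleAux_apply]

end Bimodules

section BiTensor

variable (k A : Type*) [Field k] [Ring A] [Algebra k A]

/-- The tensor product `M ⊗_A N` of two bimodules. -/
def BiTensor (M N : Type*) [AddCommGroup M] [Module (Env k A) M] [AddCommGroup N]
    [Module (Env k A) N] : Type _ :=
  Balanced (fun (a : A) (m : M) => er k a • m) (fun (a : A) (n : N) => el k a • n)

variable {k A}
variable {M N P Q M' N' : Type*} [AddCommGroup M] [Module (Env k A) M]
  [AddCommGroup N] [Module (Env k A) N] [AddCommGroup P] [Module (Env k A) P]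
  [AddCommGroup M'] [Module (Env k A) M'] [AddCommGroup N'] [Module (Env k A) N']
  [AddCommGroup Q]

namespace BiTensor

instance : AddCommGroup (BiTensor k A M N) := inferInstanceAs (AddCommGroup (Balanced _ _))

/-- The element `m ⊗ n` of `M ⊗_A N`. -/
def mk (m : M) (n : N) : BiTensor k A M N := Balanced.mk _ _ m n

theorem mk_add_left (m m' : M) (n : N) :
    (mk (m + m') n : BiTensor k A M N) = mk m n + mk m' n := Balanced.mk_add_left _ _ _

theorem mk_add_right (m : M) (n n' : N) :
    (mk m (n + n') : BiTensor k A M N) = mk m n + mk m n' := Balanced.mk_add_right _ _ _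

theorem mk_bal (a : A) (m : M) (n : N) :
    (mk (er k a • m) n : BiTensor k A M N) = mk m (el k a • n) :=
  Balanced.mk_bal (ρ := fun (a : A) (m : M) => er k a • m)
    (σ := fun (a : A) (n : N) => el k a • n) a m n

@[elab_as_elim]
theorem induction {p : BiTensor k A M N → Prop} (h : ∀ m n, p (mk m n))
    (ha : ∀ x y, p x → p y → p (x + y)) (x : BiTensor k A M N) : p x :=
  Balanced.induction h ha x

/-- The universal property of the tensor product over `A`. -/
def lift (f : M → N → Q) (h₁ : ∀ m m' n, f (m + m') n = f m n + f m' n)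
    (h₂ : ∀ m n n', f m (n + n') = f m n + f m n')
    (hf : ∀ (a : A) m n, f (er k a • m) n = f m (el k a • n)) : BiTensor k A M N →+ Q :=
  Balanced.lift (Balanced.mkHom₂ f h₁ h₂) hf

@[simp] theorem lift_mk (f : M → N → Q) (h₁ h₂) (hf : ∀ (a : A) m n,
    f (er k a • m) n = f m (el k a • n)) (m : M) (n : N) :
    lift f h₁ h₂ hf (mk m n) = f m n := rfl

theorem hom_ext {f g : BiTensor k A M N →+ Q} (h : ∀ m n, f (mk m n) = g (mk m n)) : f = g :=
  Balanced.hom_ext h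

/-- The tensor product of a morphism of right modules and a morphism of left modules. -/
def mapAux (f : M →+ M') (g : N →+ N') (hf : ∀ (a : A) m, f (er k a • m) = er k a • f m)
    (hg : ∀ (a : A) n, g (el k a • n) = el k a • g n) : BiTensor k A M N →+ BiTensor k A M' N' :=
  lift (fun m n => mk (f m) (g n)) (fun m m' n => by rw [map_add, mk_add_left])
    (fun m n n' => by rw [map_add, mk_add_right]) (fun a m n => by rw [hf, hg, mk_bal])

@[simp] theorem mapAux_mk (f : M →+ M') (g : N →+ N') (hf : ∀ (a : A) m, f (er k a • m) = er k a • f m)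
    (hg : ∀ (a : A) n, g (el k a • n) = el k a • g n) (m : M) (n : N) :
    mapAux f g hf hg (mk m n) = mk (f m) (g n) := rfl

/-- `a ⊗ b` acts on `M ⊗_A N` by `m ⊗ n ↦ a m ⊗ n b`. -/
def actAux (a b : A) : BiTensor k A M N →+ BiTensor k A M N :=
  mapAux (DistribSMul.toAddMonoidHom M (el k a)) (DistribSMul.toAddMonoidHom N (er k b))
    (fun c m => by
      simp only [DistribSMul.toAddMonoidHom_apply, smul_smul, el_mul_er])
    (fun c n => by
      simp only [DistribSMul.toAddMonoidHom_apply, smul_smul, el_mul_er])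

theorem actAux_mk (a b : A) (m : M) (n : N) :
    actAux a b (mk m n : BiTensor k A M N) = mk (el k a • m) (er k b • n) := rfl

/-- The action of the enveloping algebra on `M ⊗_A N`, as an additive map. -/
def actHom : Env k A →+ BiTensor k A M N →+ BiTensor k A M N :=
  TensorProduct.liftAddHom
    (Balanced.mkHom₂ (fun (a : A) (b : Aᵐᵒᵖ) => actAux a (unop b))
      (fun a a' b => hom_ext fun m n => by
        rw [AddMonoidHom.add_apply, actAux_mk, actAux_mk, actAux_mk, el_add, add_smul, mk_add_left])
      (fun a b b' => hom_ext fun m n => by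
        rw [AddMonoidHom.add_apply, actAux_mk, actAux_mk, actAux_mk, ← mk_add_right, ← add_smul,
          ← er_add]
        rfl))
    (fun c a b => hom_ext fun m n => by
      change actAux (c • a) (unop b) (mk m n) = actAux a (unop (c • b)) (mk m n)
      rw [actAux_mk, actAux_mk, Algebra.smul_def, unop_smul, Algebra.smul_def, el_mul, er_mul,
        el_algebraMap, mul_smul, mk_bal, ← el_algebraMap, ← el_mul_er, mul_smul])

theorem actHom_mk (a b : A) (m : M) (n : N) :
    actHom (el k a * er k b) (mk m n : BiTensor k A M N) = mk (el k a • m) (er k b • n) := by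
  have : el k a * er k b = a ⊗ₜ op b := (tmul_eq k a (op b)).symm
  rw [this]; rfl

/-- The bimodule structure of `M ⊗_A N`: `a (m ⊗ n) b = a m ⊗ n b`. -/
instance : Module (Env k A) (BiTensor k A M N) where
  smul x t := actHom x t
  smul_zero x := map_zero (actHom x)
  smul_add x := map_add (actHom x)
  zero_smul t := by change actHom 0 t = 0; rw [map_zero]; rfl
  add_smul x y t := by change actHom (x + y) t = _; rw [map_add]; rfl
  one_smul t := by
    change actHom 1 t = t
    induction t using induction with
    | h m n =>
      have := actHom_mk (k := k) (1 : A) 1 m n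
      rwa [el_one, er_one, mul_one, one_smul, one_smul] at this
    | ha x y hx hy => rw [map_add, hx, hy]
  mul_smul x y t := by
    change actHom (x * y) t = actHom x (actHom y t)
    induction t using induction with
    | ha t u ht hu => simp only [map_add, ht, hu]
    | h m n =>
      induction x using env_induction with
      | ha x x' hx hx' => simp only [add_mul, map_add, AddMonoidHom.add_apply, hx, hx']
      | h a b =>
        induction y using env_induction with
        | ha y y' hy hy' => simp only [mul_add, map_add, AddMonoidHom.add_apply, hy, hy']
        | h c d =>
          have : el k a * er k b * (el k c * er k d) = el k (a * c) * er k (d * b) := by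
            rw [mul_assoc, ← mul_assoc (er k b), ← el_mul_er, el_mul, er_mul]
            simp only [mul_assoc]
          rw [this, actHom_mk, actHom_mk, actHom_mk, el_mul, er_mul, mul_smul, mul_smul]

theorem smul_mk (a b : A) (m : M) (n : N) :
    (el k a * er k b) • (mk m n : BiTensor k A M N) = mk (el k a • m) (er k b • n) :=
  actHom_mk a b m n

theorem el_smul_mk (a : A) (m : M) (n : N) :
    el k a • (mk m n : BiTensor k A M N) = mk (el k a • m) n := by
  have := smul_mk (k := k) a 1 m n
  rwa [er_one, mul_one, one_smul] at this

theorem er_smul_mk (a : A) (m : M) (n : N) :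
    er k a • (mk m n : BiTensor k A M N) = mk m (er k a • n) := by
  have := smul_mk (k := k) 1 a m n
  rwa [el_one, one_mul, one_smul] at this

/-- An additive map which commutes with the two actions of `A` is a bimodule map. -/
def _root_.HopfAlgebroids.mkLin (f : M →+ N) (hl : ∀ (a : A) m, f (el k a • m) = el k a • f m)
    (hr : ∀ (a : A) m, f (er k a • m) = er k a • f m) : M →ₗ[Env k A] N :=
  { f with
    map_smul' := fun x m => by
      change f (x • m) = x • f m
      induction x using env_induction with
      | h a b => rw [mul_smul, hl, hr, mul_smul]
      | ha x y hx hy => rw [add_smul, map_add, hx, hy, add_smul] }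

/-- The tensor product `f ⊗ g` of two bimodule maps. -/
def map (f : M →ₗ[Env k A] M') (g : N →ₗ[Env k A] N') :
    BiTensor k A M N →ₗ[Env k A] BiTensor k A M' N' :=
  mkLin (mapAux f.toAddMonoidHom g.toAddMonoidHom (fun _ _ => map_smul f _ _)
      (fun _ _ => map_smul g _ _))
    (fun a t => by
      induction t using induction with
      | h m n =>
        rw [el_smul_mk]
        change mk (f (el k a • m)) (g n) = el k a • mk (f m) (g n)
        rw [el_smul_mk, map_smul]
      | ha x y hx hy => rw [smul_add, map_add, map_add, smul_add, hx, hy])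
    (fun a t => by
      induction t using induction with
      | h m n =>
        rw [er_smul_mk]
        change mk (f m) (g (er k a • n)) = er k a • mk (f m) (g n)
        rw [er_smul_mk, map_smul]
      | ha x y hx hy => rw [smul_add, map_add, map_add, smul_add, hx, hy])

@[simp] theorem map_mk (f : M →ₗ[Env k A] M') (g : N →ₗ[Env k A] N') (m : M) (n : N) :
    map f g (mk m n) = mk (f m) (g n) := rfl

/-- The associativity constraint `(m ⊗ n) ⊗ p ↦ m ⊗ (n ⊗ p)`. -/
def assoc : BiTensor k A (BiTensor k A M N) P →+ BiTensor k A M (BiTensor k A N P) :=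
  lift (fun t p => lift (Q := BiTensor k A M (BiTensor k A N P)) (fun m n => mk m (mk n p))
      (fun m m' n => mk_add_left _ _ _) (fun m n n' => by rw [mk_add_left, mk_add_right])
      (fun a m n => by rw [mk_bal, el_smul_mk]) t)
    (fun t t' p => map_add _ _ _)
    (fun t p p' => by
      induction t using induction with
      | h m n => rw [lift_mk, lift_mk, lift_mk, mk_add_right, mk_add_right]
      | ha x y hx hy => rw [map_add, map_add, map_add, hx, hy]; abel)
    (fun a t p => by
      induction t using induction with
      | h m n => rw [er_smul_mk, lift_mk, lift_mk, mk_bal]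
      | ha x y hx hy => rw [smul_add, map_add, map_add, hx, hy])

@[simp] theorem assoc_mk (m : M) (n : N) (p : P) :
    assoc (mk (mk m n : BiTensor k A M N) p) = mk m (mk n p : BiTensor k A N P) := rfl

/-- The left unit constraint `a ⊗ m ↦ a m`. -/
def lid : BiTensor k A A M →+ M :=
  lift (fun a m => el k a • m) (fun a a' m => by rw [el_add, add_smul]) (fun a m m' => smul_add _ _ _)
    (fun a b m => by rw [er_smul, el_mul, mul_smul])

@[simp] theorem lid_mk (a : A) (m : M) : lid (mk a m : BiTensor k A A M) = el k a • m := rfl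

/-- The right unit constraint `m ⊗ a ↦ m a`. -/
def rid : BiTensor k A M A →+ M :=
  lift (fun m a => er k a • m) (fun a a' m => smul_add _ _ _) (fun m a a' => by rw [er_add, add_smul])
    (fun a m b => by rw [el_smul, er_mul, mul_smul])

@[simp] theorem rid_mk (m : M) (a : A) : rid (mk m a : BiTensor k A M A) = er k a • m := rfl

theorem map_map {M'' N'' : Type*} [AddCommGroup M''] [Module (Env k A) M''] [AddCommGroup N'']
    [Module (Env k A) N''] (f : M →ₗ[Env k A] M') (g : N →ₗ[Env k A] N')
    (f' : M' →ₗ[Env k A] M'') (g' : N' →ₗ[Env k A] N'') (t : BiTensor k A M N) :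
    map f' g' (map f g t) = map (f' ∘ₗ f) (g' ∘ₗ g) t := by
  induction t using induction with
  | h m n => rfl
  | ha x y hx hy => rw [map_add, map_add, map_add, hx, hy]

/-- The inverse `m ↦ 1 ⊗ m` of the left unit constraint. -/
def lidInv : M →ₗ[Env k A] BiTensor k A A M :=
  mkLin (AddMonoidHom.mk' (fun m => mk 1 m) (fun m n => mk_add_right _ _ _))
    (fun a m => by
      change mk 1 (el k a • m) = el k a • mk 1 m
      rw [el_smul_mk, ← mk_bal, el_smul, er_smul, one_mul, mul_one])
    (fun a m => by
      change mk 1 (er k a • m) = er k a • mk 1 m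
      rw [er_smul_mk])

end BiTensor
end BiTensor

/-! ## Rings over the enveloping algebra and the functor `H ⊠ -` -/

section EnvRing

variable (k A H : Type*) [Field k] [Ring A] [Algebra k A] [Ring H] [Algebra k H]

/-- An `Aᵉ`-ring structure on the `k`-algebra `H`. The `Aᵉ`-bimodule structure of `H` is the one
induced by `η`: the left action is `x h = η x * h` and the right action is `h x = h * η x`. -/
class EnvRing where
  /-- the structure map, combining source and target maps -/
  η : Env k A →ₐ[k] H

variable [EnvRing k A H]

/-- The left action of `Aᵉ` on `H`. It makes `H` an `A`-bimodule. -/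
instance leftBimodule : Module (Env k A) H :=
  Module.compHom H (EnvRing.η (k := k) (A := A) (H := H)).toRingHom

variable {A} in
/-- The source map. -/
def src (a : A) : H := EnvRing.η (el k a)

variable {A} in
/-- The target map. -/
def tgt (a : A) : H := EnvRing.η (er k a)

variable {k A H}

theorem smul_eq (x : Env k A) (h : H) : x • h = EnvRing.η x * h := rfl

theorem el_smul_eq (a : A) (h : H) : el k a • h = src k H a * h := rfl

theorem er_smul_eq (a : A) (h : H) : er k a • h = tgt k H a * h := rfl

instance : IsScalarTower (Env k A) H H := ⟨fun x h h' => by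
  simp only [smul_eq, smul_eq_mul, mul_assoc]⟩

theorem src_one : src k H (1 : A) = 1 := map_one _

theorem tgt_one : tgt k H (1 : A) = 1 := map_one _

theorem η_smul {N : Type*} [AddCommGroup N] [Module (Env k A) N] [Module H N]
    [IsScalarTower (Env k A) H N] (x : Env k A) (n : N) :
    (EnvRing.η x : H) • n = x • n := by
  have := smul_assoc x (1 : H) n
  rwa [one_smul, smul_eq, mul_one] at this

theorem src_smul {N : Type*} [AddCommGroup N] [Module (Env k A) N] [Module H N]
    [IsScalarTower (Env k A) H N] (a : A) (n : N) : src k H a • n = el k a • n := η_smul _ _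

theorem tgt_smul {N : Type*} [AddCommGroup N] [Module (Env k A) N] [Module H N]
    [IsScalarTower (Env k A) H N] (a : A) (n : N) : tgt k H a • n = er k a • n := η_smul _ _

variable (k A H) in
/-- The underlying abelian group of `H ⊠ M = H ⊗_{Aᵉ} M`, for an `A`-bimodule `M`. -/
def Box (M : Type*) [AddCommGroup M] [Module (Env k A) M] : Type _ :=
  Balanced (fun (x : Env k A) (h : H) => h * EnvRing.η x) (fun (x : Env k A) (m : M) => x • m)

namespace Box

variable {M N P Q : Type*} [AddCommGroup M] [Module (Env k A) M] [AddCommGroup N]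
  [Module (Env k A) N] [AddCommGroup P] [Module (Env k A) P] [AddCommGroup Q]

instance : AddCommGroup (Box k A H M) := inferInstanceAs (AddCommGroup (Balanced _ _))

/-- The element `h ⊠ m`. -/
def mk (h : H) (m : M) : Box k A H M := Balanced.mk _ _ h m

theorem mk_add_left (h h' : H) (m : M) :
    (mk (h + h') m : Box k A H M) = mk h m + mk h' m := Balanced.mk_add_left _ _ _

theorem mk_add_right (h : H) (m m' : M) :
    (mk h (m + m') : Box k A H M) = mk h m + mk h m' := Balanced.mk_add_right _ _ _

theorem mk_bal (x : Env k A) (h : H) (m : M) :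
    (mk (h * EnvRing.η x) m : Box k A H M) = mk h (x • m) :=
  Balanced.mk_bal (ρ := fun (x : Env k A) (h : H) => h * EnvRing.η x)
    (σ := fun (x : Env k A) (m : M) => x • m) x h m

@[elab_as_elim]
theorem induction {p : Box k A H M → Prop} (h : ∀ b m, p (mk b m))
    (ha : ∀ x y, p x → p y → p (x + y)) (x : Box k A H M) : p x :=
  Balanced.induction h ha x

/-- The universal property of `H ⊠ M`. -/
def lift (f : H → M → Q) (h₁ : ∀ m m' n, f (m + m') n = f m n + f m' n)
    (h₂ : ∀ m n n', f m (n + n') = f m n + f m n')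
    (hf : ∀ (x : Env k A) h m, f (h * EnvRing.η x) m = f h (x • m)) : Box k A H M →+ Q :=
  Balanced.lift (Balanced.mkHom₂ f h₁ h₂) hf

@[simp] theorem lift_mk (f : H → M → Q) (h₁ h₂) (hf : ∀ (x : Env k A) h m,
    f (h * EnvRing.η x) m = f h (x • m)) (h : H) (m : M) :
    lift f h₁ h₂ hf (mk h m) = f h m := rfl

theorem hom_ext {f g : Box k A H M →+ Q} (h : ∀ b m, f (mk b m) = g (mk b m)) : f = g :=
  Balanced.hom_ext h

/-- Left multiplication by `h` on `H ⊠ M`. -/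
def act (h : H) : Box k A H M →+ Box k A H M :=
  lift (fun b m => mk (h * b) m) (fun b b' m => by rw [mul_add, mk_add_left])
    (fun b m m' => mk_add_right _ _ _) (fun x b m => by rw [← mul_assoc, mk_bal])

/-- The free `H`-module structure of `H ⊠ M`: `h (b ⊠ m) = (h b) ⊠ m`. -/
instance : Module H (Box k A H M) where
  smul h t := act h t
  smul_zero h := map_zero (act h)
  smul_add h := map_add (act h)
  zero_smul t := by
    change act 0 t = 0
    induction t using induction with
    | h b m =>
      change mk (0 * b) m = 0
      rw [zero_mul]
      have := mk_add_left (k := k) (A := A) (0 : H) 0 m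
      rwa [add_zero, left_eq_add] at this
    | ha x y hx hy => rw [map_add, hx, hy, add_zero]
  add_smul h h' t := by
    change act (h + h') t = act h t + act h' t
    induction t using induction with
    | h b m =>
      change mk ((h + h') * b) m = mk (h * b) m + mk (h' * b) m
      rw [add_mul, mk_add_left]
    | ha x y hx hy => rw [map_add, map_add, map_add, hx, hy]; abel
  one_smul t := by
    change act 1 t = t
    induction t using induction with
    | h b m => exact congrArg (mk · m) (one_mul b)
    | ha x y hx hy => rw [map_add, hx, hy]
  mul_smul h h' t := by
    change act (h * h') t = act h (act h' t)
    induction t using induction with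
    | h b m => exact congrArg (mk · m) (mul_assoc _ _ _)
    | ha x y hx hy => rw [map_add, map_add, map_add, hx, hy]

/-- The bimodule structure of `H ⊠ M`, induced by the left action of `Aᵉ` on `H`. -/
instance : Module (Env k A) (Box k A H M) :=
  Module.compHom _ (EnvRing.η (k := k) (A := A) (H := H)).toRingHom

theorem smul_mk (h b : H) (m : M) : h • (mk b m : Box k A H M) = mk (h * b) m := rfl

theorem env_smul (x : Env k A) (t : Box k A H M) : x • t = (EnvRing.η x : H) • t := rfl

instance : IsScalarTower (Env k A) H (Box k A H M) := ⟨fun x h t => by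
  rw [smul_eq, mul_smul, env_smul]⟩

/-- An additive map from `H ⊠ M` which commutes with the action of `Aᵉ` is a bimodule map. -/
def linOfSMul (f : Box k A H M →+ N) (h : ∀ (x : Env k A) (b : H) (m : M),
      f (x • mk b m) = x • f (mk b m)) :
    Box k A H M →ₗ[Env k A] N :=
  { f with
    map_smul' := fun x t => by
      change f (x • t) = x • f t
      induction t using induction with
      | h b m => exact h x b m
      | ha t u ht hu => rw [smul_add, map_add, map_add, smul_add, ht, hu] }

/-- The `H`-linear map `H ⊠ f`, `h ⊠ m ↦ h ⊠ f m`. -/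
def mapH (f : M →ₗ[Env k A] N) : Box k A H M →ₗ[H] Box k A H N :=
  { lift (Q := Box k A H N) (fun h m => mk h (f m)) (fun h h' m => mk_add_left _ _ _)
      (fun h m m' => by rw [map_add, mk_add_right])
      (fun x h m => by rw [mk_bal, map_smul]) with
    map_smul' := fun h t => by
      induction t using induction with
      | h b m => rfl
      | ha x y hx hy =>
        simp only [smul_add, RingHom.id_apply] at hx hy ⊢
        rw [AddMonoidHom.toFun_eq_coe] at hx hy ⊢
        rw [map_add, map_add, smul_add, hx, hy] }

/-- The bimodule map `H ⊠ f`, `h ⊠ m ↦ h ⊠ f m`. -/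
def map (f : M →ₗ[Env k A] N) : Box k A H M →ₗ[Env k A] Box k A H N :=
  (mapH f).restrictScalars (Env k A)

@[simp] theorem map_mk (f : M →ₗ[Env k A] N) (h : H) (m : M) :
    map f (mk h m : Box k A H M) = mk h (f m) := rfl

@[simp] theorem mapH_mk (f : M →ₗ[Env k A] N) (h : H) (m : M) :
    mapH f (mk h m : Box k A H M) = mk h (f m) := rfl

variable (H) in
/-- The unit `M → H ⊠ M`, `m ↦ 1 ⊠ m`, of the monad `H ⊠ -`. -/
def unit : M →ₗ[Env k A] Box k A H M :=
  { toFun := fun m => mk 1 m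
    map_add' := fun m m' => mk_add_right _ _ _
    map_smul' := fun x m => by
      rw [RingHom.id_apply, env_smul, smul_mk, ← mk_bal, mul_one, one_mul] }

@[simp] theorem unit_apply (m : M) : unit H m = (mk 1 m : Box k A H M) := rfl

/-- The bimodule map `h ↦ h ⊠ m` from `H` (with its left action of `Aᵉ`) to `H ⊠ M`. -/
def incl (m : M) : H →ₗ[Env k A] Box k A H M :=
  { toFun := fun h => mk h m
    map_add' := fun _ _ => mk_add_left _ _ _
    map_smul' := fun _ _ => rfl }

@[simp] theorem incl_apply (m : M) (h : H) : incl m h = (mk h m : Box k A H M) := rfl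

/-- The bimodule map `H ⊠ M → M`, `h ⊠ m ↦ h m`, for an `H`-module `M`. -/
def ofModule (M : Type*) [AddCommGroup M] [Module (Env k A) M] [Module H M]
    [IsScalarTower (Env k A) H M] : Box k A H M →ₗ[Env k A] M :=
  linOfSMul
    (lift (fun h m => h • m) (fun h h' m => add_smul _ _ _) (fun h m m' => smul_add _ _ _)
      (fun x h m => by rw [mul_smul, η_smul]))
    (fun x b m => smul_assoc x b m)

@[simp] theorem ofModule_mk (M : Type*) [AddCommGroup M] [Module (Env k A) M] [Module H M]
    [IsScalarTower (Env k A) H M] (h : H) (m : M) :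
    ofModule M (mk h m : Box k A H M) = h • m := rfl

variable (H M) in
/-- The multiplication `H ⊠ (H ⊠ M) → H ⊠ M`, `h ⊠ (h' ⊠ m) ↦ (h h') ⊠ m`, of the monad
`H ⊠ -`. -/
def mul : Box k A H (Box k A H M) →ₗ[Env k A] Box k A H M := ofModule (Box k A H M)

theorem mul_mk_mk (h h' : H) (m : M) :
    mul H M (mk h (mk h' m : Box k A H M)) = mk (h * h') m := rfl

end Box

end EnvRing

/-! ## Bialgebroids and Hopf algebroids -/

section Bialgebroid

variable (k A H : Type*) [Field k] [Ring A] [Algebra k A] [Ring H] [Algebra k H] [EnvRing k A H]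

variable {k A H} in
/-- The map `b ⊗ b' ↦ b x ⊗ b' y` on `H ⊗_A H`. -/
def mulRight (x y : H) : BiTensor k A H H →+ BiTensor k A H H :=
  BiTensor.mapAux (AddMonoidHom.mulRight x) (AddMonoidHom.mulRight y)
    (fun _ _ => mul_assoc _ _ _) (fun _ _ => mul_assoc _ _ _)

variable {k A H} in
@[simp] theorem mulRight_mk (x y b b' : H) :
    mulRight x y (BiTensor.mk b b' : BiTensor k A H H) = BiTensor.mk (b * x) (b' * y) := rfl

/-- An `A|A`-coring structure on `H`, where `H ⊗_A H` is formed with the `A`-bimodule structure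
given by the left action of `Aᵉ` on `H`. -/
class Coring where
  /-- the comultiplication -/
  Δ : H →ₗ[Env k A] BiTensor k A H H
  /-- the counit -/
  ε : H →ₗ[Env k A] A
  coassoc : ∀ b, BiTensor.assoc (BiTensor.map Δ LinearMap.id (Δ b)) =
    BiTensor.map LinearMap.id Δ (Δ b)
  counit_left : ∀ b, BiTensor.lid (BiTensor.map ε LinearMap.id (Δ b)) = b
  counit_right : ∀ b, BiTensor.rid (BiTensor.map LinearMap.id ε (Δ b)) = b
  Δ_mul_right : ∀ (b : H) (r s : A),
    Δ (b * (src k H r * tgt k H s)) = mulRight (src k H r) (tgt k H s) (Δ b)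
  ε_mul_right : ∀ (b : H) (r : A), ε (b * src k H r) = ε (b * tgt k H r)

section Eval

variable {k A H} {M N : Type*} [AddCommGroup M] [Module (Env k A) M] [Module H M]
  [IsScalarTower (Env k A) H M] [AddCommGroup N] [Module (Env k A) N] [Module H N]
  [IsScalarTower (Env k A) H N]

/-- The map `x ⊗ y ↦ x m ⊗ y n` from `H ⊗_A H` to `M ⊗_A N`, for elements `m` and `n` of
`H`-modules `M` and `N`. -/
def evalAt (m : M) (n : N) : BiTensor k A H H →+ BiTensor k A M N :=
  BiTensor.lift (fun x y => BiTensor.mk (x • m) (y • n))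
    (fun x x' y => by rw [add_smul, BiTensor.mk_add_left])
    (fun x y y' => by rw [add_smul, BiTensor.mk_add_right])
    (fun a x y => by rw [smul_assoc, smul_assoc, BiTensor.mk_bal])

@[simp] theorem evalAt_mk (m : M) (n : N) (x y : H) :
    evalAt m n (BiTensor.mk x y : BiTensor k A H H) = BiTensor.mk (x • m) (y • n) := rfl

theorem evalAt_mulRight (m : M) (n : N) (x y : H) (t : BiTensor k A H H) :
    evalAt m n (mulRight x y t) = evalAt (x • m) (y • n) t := by
  induction t using BiTensor.induction with
  | h b b' => rw [mulRight_mk, evalAt_mk, evalAt_mk, mul_smul, mul_smul]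
  | ha x y hx hy => simp only [map_add, hx, hy]

theorem evalAt_add_left (m m' : M) (n : N) (t : BiTensor k A H H) :
    evalAt (m + m') n t = evalAt m n t + evalAt m' n t := by
  induction t using BiTensor.induction with
  | h b b' => rw [evalAt_mk, evalAt_mk, evalAt_mk, smul_add, BiTensor.mk_add_left]
  | ha x y hx hy => rw [map_add, map_add, map_add, hx, hy]; abel

theorem evalAt_add_right (m : M) (n n' : N) (t : BiTensor k A H H) :
    evalAt m (n + n') t = evalAt m n t + evalAt m n' t := by
  induction t using BiTensor.induction with
  | h b b' => rw [evalAt_mk, evalAt_mk, evalAt_mk, smul_add, BiTensor.mk_add_right]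
  | ha x y hx hy => rw [map_add, map_add, map_add, hx, hy]; abel

theorem evalAt_env (m : M) (n : N) (x : Env k A) (t : BiTensor k A H H) :
    evalAt m n (x • t) = x • evalAt m n t := by
  induction t using BiTensor.induction with
  | h b b' =>
    induction x using env_induction with
    | h a c =>
      rw [BiTensor.smul_mk, evalAt_mk, evalAt_mk, BiTensor.smul_mk, smul_assoc, smul_assoc]
    | ha x y hx hy => rw [add_smul, map_add, hx, hy, add_smul]
  | ha x y hx hy => rw [smul_add, map_add, map_add, smul_add, hx, hy]

end Eval

variable [Coring k A H]

/-- The comultiplication of `H`. -/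
abbrev comul : H →ₗ[Env k A] BiTensor k A H H := Coring.Δ

/-- The counit of `H`. -/
abbrev counit : H →ₗ[Env k A] A := Coring.ε

variable {k A H}

theorem comul_mul_src (b : H) (r : A) :
    comul k A H (b * src k H r) = mulRight (src k H r) 1 (comul k A H b) := by
  have := Coring.Δ_mul_right (k := k) b r (1 : A)
  rwa [tgt_one, mul_one] at this

theorem comul_mul_tgt (b : H) (r : A) :
    comul k A H (b * tgt k H r) = mulRight 1 (tgt k H r) (comul k A H b) := by
  have := Coring.Δ_mul_right (k := k) b (1 : A) r
  rwa [src_one, one_mul] at this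

/-- The map `y ⊗ z ↦ ε(y t(a)) z` on `H ⊗_A H`. -/
def takeuchiAux (a : A) : BiTensor k A H H →+ H :=
  BiTensor.lift (fun y z => src k H (counit k A H (y * tgt k H a)) * z)
    (fun y y' z => by rw [add_mul, map_add, src, el_add, map_add, add_mul]; rfl)
    (fun y z z' => mul_add _ _ _)
    (fun c y z => by
      rw [er_smul_eq, mul_assoc, ← er_smul_eq, map_smul, er_smul, el_smul_eq, src, el_mul, map_mul,
        mul_assoc]
      rfl)

theorem takeuchiAux_mk (a : A) (y z : H) : takeuchiAux a (BiTensor.mk y z : BiTensor k A H H) =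
    src k H (counit k A H (y * tgt k H a)) * z := rfl

theorem takeuchiAux_el (a c : A) (t : BiTensor k A H H) :
    takeuchiAux a (el k c • t) = el k c • takeuchiAux a t := by
  induction t using BiTensor.induction with
  | h y z =>
    rw [BiTensor.el_smul_mk]
    have h : counit k A H (src k H c * (y * tgt k H a)) = c * counit k A H (y * tgt k H a) := by
      rw [← el_smul_eq, map_smul, el_smul]
    have h' : src k H (c * counit k A H (y * tgt k H a)) =
        src k H c * src k H (counit k A H (y * tgt k H a)) := by
      rw [src, el_mul, map_mul]; rfl
    rw [takeuchiAux_mk, takeuchiAux_mk, el_smul_eq, el_smul_eq, mul_assoc, h, h', mul_assoc]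
  | ha x y hx hy => rw [smul_add, map_add, map_add, smul_add, hx, hy]

theorem takeuchiAux_comul (a : A) (y : H) :
    takeuchiAux a (comul k A H y) = y * src k H a := by
  rw [← Coring.counit_left (k := k) (A := A) (y * src k H a)]
  change _ = BiTensor.lid (BiTensor.map _ _ (comul k A H (y * src k H a)))
  rw [comul_mul_src]
  generalize comul k A H y = t
  induction t using BiTensor.induction with
  | h y z =>
    rw [mulRight_mk, BiTensor.map_mk, BiTensor.lid_mk, Coring.ε_mul_right, LinearMap.id_apply,
      mul_one]
    rfl
  | ha x y hx hy => simp only [map_add, hx, hy]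

/-- The comultiplication takes values in the Takeuchi product. -/
theorem takeuchi (a : A) (b : H) :
    mulRight (tgt k H a) 1 (comul k A H b) = mulRight 1 (src k H a) (comul k A H b) := by
  have key := congrArg (BiTensor.mapAux (AddMonoidHom.id H) (takeuchiAux a) (fun _ _ => rfl)
    (fun c t => takeuchiAux_el a c t)) (Coring.coassoc (k := k) (A := A) b)
  have h1 : ∀ t : BiTensor k A H H, BiTensor.mapAux (AddMonoidHom.id H) (takeuchiAux a)
      (fun _ _ => rfl) (fun c t => takeuchiAux_el a c t)
      (BiTensor.map LinearMap.id (comul k A H) t) = mulRight 1 (src k H a) t := by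
    intro t
    induction t using BiTensor.induction with
    | h x y =>
      rw [BiTensor.map_mk, BiTensor.mapAux_mk, mulRight_mk, takeuchiAux_comul, mul_one]
      rfl
    | ha x y hx hy => simp only [map_add, hx, hy]
  have h3 : ∀ (w : BiTensor k A H H) (z : H), BiTensor.mapAux (AddMonoidHom.id H) (takeuchiAux a)
      (fun _ _ => rfl) (fun c t => takeuchiAux_el a c t) (BiTensor.assoc (BiTensor.mk w z)) =
      BiTensor.mk (BiTensor.rid (BiTensor.map LinearMap.id (counit k A H)
        (mulRight 1 (tgt k H a) w))) z := by
    intro w z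
    induction w using BiTensor.induction with
    | h u v =>
      rw [BiTensor.assoc_mk, BiTensor.mapAux_mk, mulRight_mk, BiTensor.map_mk, BiTensor.rid_mk,
        BiTensor.mk_bal, LinearMap.id_apply, mul_one]
      rfl
    | ha x y hx hy => simp only [BiTensor.mk_add_left, map_add, hx, hy]
  have h2 : ∀ t : BiTensor k A H H, BiTensor.mapAux (AddMonoidHom.id H) (takeuchiAux a)
      (fun _ _ => rfl) (fun c t => takeuchiAux_el a c t)
      (BiTensor.assoc (BiTensor.map (comul k A H) LinearMap.id t)) = mulRight (tgt k H a) 1 t := by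
    intro t
    induction t using BiTensor.induction with
    | h x y =>
      rw [BiTensor.map_mk, h3, ← comul_mul_tgt, Coring.counit_right, mulRight_mk, mul_one]
      rfl
    | ha x y hx hy => simp only [map_add, hx, hy]
  rw [← h1, ← h2]
  exact key

section Diagonal

variable {M N : Type*} [AddCommGroup M] [Module (Env k A) M] [Module H M]
  [IsScalarTower (Env k A) H M] [AddCommGroup N] [Module (Env k A) N] [Module H N]
  [IsScalarTower (Env k A) H N]

/-- The diagonal action `h (m ⊗ n) = h₁ m ⊗ h₂ n` of `h` on the tensor product `M ⊗_A N` of two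
`H`-modules. -/
def diagAct (h : H) : BiTensor k A M N →+ BiTensor k A M N :=
  BiTensor.lift (fun m n => evalAt m n (comul k A H h))
    (fun m m' n => evalAt_add_left _ _ _ _) (fun m n n' => evalAt_add_right _ _ _ _)
    (fun a m n => by
      have := congrArg (evalAt m n) (takeuchi (k := k) a h)
      rwa [evalAt_mulRight, evalAt_mulRight, one_smul, one_smul, tgt_smul, src_smul] at this)

theorem diagAct_mk (h : H) (m : M) (n : N) :
    diagAct h (BiTensor.mk m n : BiTensor k A M N) = evalAt m n (comul k A H h) := rfl

theorem diagAct_add (h h' : H) (t : BiTensor k A M N) :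
    diagAct (h + h') t = diagAct h t + diagAct h' t := by
  induction t using BiTensor.induction with
  | h m n => rw [diagAct_mk, diagAct_mk, diagAct_mk, map_add, map_add]
  | ha x y hx hy => rw [map_add, map_add, map_add, hx, hy]; abel

theorem diagAct_mul_env (h : H) (x : Env k A) (t : BiTensor k A M N) :
    diagAct (h * EnvRing.η x) t = diagAct h (x • t) := by
  induction x using env_induction with
  | ha x y hx hy => rw [map_add, mul_add, diagAct_add, hx, hy, add_smul, map_add]
  | h a b =>
    induction t using BiTensor.induction with
    | h m n =>
      rw [BiTensor.smul_mk, diagAct_mk, diagAct_mk, map_mul EnvRing.η]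
      change evalAt m n (comul k A H (h * (src k H a * tgt k H b))) = _
      rw [comul, Coring.Δ_mul_right, evalAt_mulRight, src_smul, tgt_smul]
    | ha x y hx hy => rw [smul_add, map_add, map_add, hx, hy]

theorem diagAct_env_mul (h : H) (x : Env k A) (t : BiTensor k A M N) :
    diagAct (EnvRing.η x * h) t = x • diagAct h t := by
  induction t using BiTensor.induction with
  | h m n => rw [diagAct_mk, ← smul_eq, map_smul, evalAt_env, diagAct_mk]
  | ha t u ht hu => rw [map_add, map_add, smul_add, ht, hu]

end Diagonal

variable (k A H) in
/-- The multiplicativity axioms of a left `A`-bialgebroid, for an `Aᵉ`-ring `H` with an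
`A|A`-coring structure. -/
class IsBialgebroid : Prop where
  comul_mul : ∀ b b' : H, comul k A H (b * b') = diagAct b (comul k A H b')
  comul_one : comul k A H 1 = BiTensor.mk 1 1
  counit_one : counit k A H 1 = 1
  counit_mul_src : ∀ b b' : H,
    counit k A H (b * b') = counit k A H (b * src k H (counit k A H b'))
  counit_mul_tgt : ∀ b b' : H,
    counit k A H (b * b') = counit k A H (b * tgt k H (counit k A H b'))

variable (k A H) in
/-- The map `β : H ⊗_{Aᵒᵖ} H → H ⋄ H`, `b ⊗ b' ↦ b₁ ⋄ b₂ b'`. Its source is the quotient of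
`H ⊗ H` by the relations `b t(a) ⊗ b' = b ⊗ t(a) b'`. Its target is the quotient by the relations
`t(a) b ⊗ b' = b ⊗ s(a) b'`, which is `H ⊗_A H`. -/
def galoisβ : Balanced (fun (a : A) (b : H) => b * tgt k H a) (fun (a : A) (b : H) => tgt k H a * b)
    →+ BiTensor k A H H :=
  Balanced.lift
    (Balanced.mkHom₂ (fun b b' => mulRight 1 b' (comul k A H b))
      (fun b b' c => by rw [map_add, map_add])
      (fun b c c' => by
        generalize comul k A H b = t
        induction t using BiTensor.induction with
        | h x y => rw [mulRight_mk, mulRight_mk, mulRight_mk, mul_add, BiTensor.mk_add_right]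
        | ha x y hx hy => rw [map_add, map_add, map_add, hx, hy]; abel))
    (fun a b b' => by
      rw [Balanced.mkHom₂_apply, Balanced.mkHom₂_apply, comul_mul_tgt]
      generalize comul k A H b = t
      induction t using BiTensor.induction with
      | h x y => rw [mulRight_mk, mulRight_mk, mulRight_mk, mul_one, mul_assoc]
      | ha x y hx hy => rw [map_add, map_add, map_add, hx, hy])

variable (k A H) in
/-- The map `ϑ : H ⊙ H → H ⋄ H`, `b ⊙ b' ↦ b₁ b' ⋄ b₂`. Its source is the quotient of `H ⊗ H` by
the relations `b s(a) ⊗ b' = b ⊗ s(a) b'`, and its target is the same as that of `β`. -/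
def galoisϑ : Balanced (fun (a : A) (b : H) => b * src k H a) (fun (a : A) (b : H) => src k H a * b)
    →+ BiTensor k A H H :=
  Balanced.lift
    (Balanced.mkHom₂ (fun b b' => mulRight b' 1 (comul k A H b))
      (fun b b' c => by rw [map_add, map_add])
      (fun b c c' => by
        generalize comul k A H b = t
        induction t using BiTensor.induction with
        | h x y => rw [mulRight_mk, mulRight_mk, mulRight_mk, mul_add, BiTensor.mk_add_left]
        | ha x y hx hy => rw [map_add, map_add, map_add, hx, hy]; abel))
    (fun a b b' => by
      rw [Balanced.mkHom₂_apply, Balanced.mkHom₂_apply, comul_mul_src]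
      generalize comul k A H b = t
      induction t using BiTensor.induction with
      | h x y => rw [mulRight_mk, mulRight_mk, mulRight_mk, mul_one, mul_assoc]
      | ha x y hx hy => rw [map_add, map_add, map_add, hx, hy])

variable (k A H) in
/-- A bialgebroid is a (Schauenburg) Hopf algebroid if `β` and `ϑ` are invertible. -/
class IsHopfAlgebroid : Prop extends IsBialgebroid k A H where
  bijective_β : Function.Bijective (galoisβ k A H)
  bijective_ϑ : Function.Bijective (galoisϑ k A H)

end Bialgebroid

/-! ## The comonoidal structure of `H ⊠ -` and the coalgebra `H ⊠ A` -/

section Comonoidal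

variable (k A H : Type*) [Field k] [Ring A] [Algebra k A] [Ring H] [Algebra k H] [EnvRing k A H]

variable (M N : Type*) [AddCommGroup M] [Module (Env k A) M] [AddCommGroup N] [Module (Env k A) N]

variable {k A H M N} in
theorem evalAt_unit (m : M) (n : N) (t : BiTensor k A H H) :
    evalAt (Box.unit H m) (Box.unit H n) t = BiTensor.map (Box.incl m) (Box.incl n) t := by
  induction t using BiTensor.induction with
  | h b b' =>
    rw [evalAt_mk, BiTensor.map_mk, Box.unit_apply, Box.unit_apply, Box.smul_mk, Box.smul_mk,
      mul_one, mul_one]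
    rfl
  | ha x y hx hy => rw [map_add, map_add, hx, hy]

variable [Coring k A H]

/-- The additive map underlying the comonoidal structure of `H ⊠ -`. -/
def boxT₂Aux : Box k A H (BiTensor k A M N) →+ BiTensor k A (Box k A H M) (Box k A H N) :=
  Box.lift (fun h t => diagAct h (BiTensor.map (Box.unit H) (Box.unit H) t))
    (fun _ _ _ => diagAct_add _ _ _) (fun h t t' => by rw [map_add, map_add])
    (fun x h t => by rw [diagAct_mul_env, LinearMap.map_smul])

variable {M N} in
theorem boxT₂Aux_mk (h : H) (t : BiTensor k A M N) : boxT₂Aux k A H M N (Box.mk h t) =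
    diagAct h (BiTensor.map (Box.unit H) (Box.unit H) t) := rfl

/-- The comonoidal structure
`T₂(M, N) : H ⊠ (M ⊗ N) → (H ⊠ M) ⊗ (H ⊠ N)`, `h ⊠ (m ⊗ n) ↦ (h₁ ⊠ m) ⊗ (h₂ ⊠ n)`.
It is written as `h ⊠ t ↦ h · t'` with `t'` the image of `t` under
`m ⊗ n ↦ (1 ⊠ m) ⊗ (1 ⊠ n)` and the diagonal action of `h`. -/
def boxT₂ : Box k A H (BiTensor k A M N) →ₗ[Env k A]
    BiTensor k A (Box k A H M) (Box k A H N) :=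
  Box.linOfSMul (boxT₂Aux k A H M N) (fun x h t => by
    rw [Box.env_smul, Box.smul_mk, boxT₂Aux_mk, boxT₂Aux_mk, diagAct_env_mul])

variable {M N} in
theorem boxT₂_mk (h : H) (t : BiTensor k A M N) : boxT₂ k A H M N (Box.mk h t) =
    diagAct h (BiTensor.map (Box.unit H) (Box.unit H) t) := rfl

variable {M N} in
/-- `T₂(h ⊠ (m ⊗ n)) = (h₁ ⊠ m) ⊗ (h₂ ⊠ n)`. -/
theorem boxT₂_mk_mk (h : H) (m : M) (n : N) :
    boxT₂ k A H M N (Box.mk h (BiTensor.mk m n)) =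
      BiTensor.map (Box.incl m) (Box.incl n) (comul k A H h) := by
  rw [boxT₂_mk, BiTensor.map_mk, diagAct_mk, evalAt_unit]

/-- The map `T₀ : H ⊠ A → A`, `h ⊠ a ↦ ε(h s(a))`. It is the counit of the coalgebra `H ⊠ A`. -/
def boxT₀ : Box k A H A →ₗ[Env k A] A :=
  Box.linOfSMul
    (Box.lift (fun h a => counit k A H (h * src k H a))
      (fun h h' a => by rw [add_mul, map_add])
      (fun h a a' => by rw [src, el_add, map_add, mul_add, map_add]; rfl)
      (fun x h a => by
        induction x using env_induction with
        | h c d =>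
          have h1 : h * EnvRing.η (el k c * er k d) * src k H a =
              h * src k H c * src k H a * tgt k H d := by
            rw [mul_assoc, src, src, tgt, ← map_mul, mul_assoc (el k c), ← el_mul_er, map_mul,
              map_mul]
            simp only [mul_assoc]
          have h2 : h * src k H ((el k c * er k d) • a) =
              h * src k H c * src k H a * src k H d := by
            rw [mul_smul, er_smul, el_smul, src, el_mul, el_mul, map_mul, map_mul]
            simp only [mul_assoc]
            rfl
          rw [h1, h2, counit, Coring.ε_mul_right]
        | ha x y hx hy =>
          have e : src k H (x • a + y • a) = src k H (x • a) + src k H (y • a) := by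
            rw [src, el_add, map_add]; rfl
          rw [map_add, mul_add, add_mul, map_add, hx, hy, add_smul, e, mul_add, map_add]))
    (fun x b m => by
      change counit k A H (EnvRing.η x * b * _) = x • counit k A H (b * _)
      rw [mul_assoc, ← smul_eq, map_smul])

@[simp] theorem boxT₀_mk (h : H) (a : A) :
    boxT₀ k A H (Box.mk h a) = counit k A H (h * src k H a) := rfl

/-- The coalgebra `H ⊠ A`, the quotient of `H` by the left ideal generated by the
`s(a) - t(a)`. -/
abbrev UnitCoalg : Type _ := Box k A H A

/-- The projection `H → H ⊠ A`, `h ↦ h ⊠ 1`. -/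
abbrev proj : H →ₗ[Env k A] UnitCoalg k A H := Box.incl 1

/-- The comultiplication `h ⊠ a ↦ (h₁ ⊠ 1) ⊗ (h₂ ⊠ a)` of the coalgebra `H ⊠ A`, that is
`T₂(A, A)` composed with `H ⊠ A ≅ H ⊠ (A ⊗ A)`. -/
def comulU : UnitCoalg k A H →ₗ[Env k A] BiTensor k A (UnitCoalg k A H) (UnitCoalg k A H) :=
  boxT₂ k A H A A ∘ₗ Box.map BiTensor.lidInv

/-- The counit `h ⊠ a ↦ ε(h s(a))` of the coalgebra `H ⊠ A`. -/
abbrev counitU : UnitCoalg k A H →ₗ[Env k A] A := boxT₀ k A H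

theorem comulU_proj (h : H) : comulU k A H (proj k A H h) =
    BiTensor.map (proj k A H) (proj k A H) (comul k A H h) :=
  boxT₂_mk_mk k A H h 1 1

theorem counitU_proj (h : H) : counitU k A H (proj k A H h) = counit k A H h := by
  change counit k A H (h * src k H 1) = _
  rw [src_one, mul_one]

/-- The right fusion operator `H ⊠ ((H ⊠ A) ⊗ M) → (H ⊠ A) ⊗ (H ⊠ M)` at the unit object `A`,
the composition of `T₂` with the multiplication `H ⊠ (H ⊠ A) → H ⊠ A`. -/
def fusionR : Box k A H (BiTensor k A (UnitCoalg k A H) M) →ₗ[Env k A]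
    BiTensor k A (UnitCoalg k A H) (Box k A H M) :=
  BiTensor.map (Box.mul H A) LinearMap.id ∘ₗ boxT₂ k A H (UnitCoalg k A H) M

/-- The free coaction `H ⊠ M → (H ⊠ A) ⊗ (H ⊠ M)`, `h ⊠ m ↦ π(h₁) ⊗ (h₂ ⊠ m)`, that is `T₂(A, M)`
composed with `H ⊠ M ≅ H ⊠ (A ⊗ M)`. -/
def freeCoaction : Box k A H M →ₗ[Env k A] BiTensor k A (UnitCoalg k A H) (Box k A H M) :=
  boxT₂ k A H A M ∘ₗ Box.map BiTensor.lidInv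

variable {M N}

theorem freeCoaction_mk' (h : H) (m : M) : freeCoaction k A H M (Box.mk h m) =
    diagAct h (BiTensor.map (Box.unit H) (Box.unit H) (BiTensor.lidInv m)) :=
  boxT₂_mk k A H h _

theorem freeCoaction_mk (h : H) (m : M) : freeCoaction k A H M (Box.mk h m) =
    BiTensor.map (proj k A H) (Box.incl m) (comul k A H h) :=
  boxT₂_mk_mk k A H h 1 m

variable {k A H}

theorem assoc_map {M' N' P P' : Type*} [AddCommGroup M'] [Module (Env k A) M'] [AddCommGroup N']
    [Module (Env k A) N'] [AddCommGroup P] [Module (Env k A) P] [AddCommGroup P']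
    [Module (Env k A) P'] (f : M →ₗ[Env k A] M') (g : N →ₗ[Env k A] N') (h : P →ₗ[Env k A] P')
    (t : BiTensor k A (BiTensor k A M N) P) :
    BiTensor.assoc (BiTensor.map (BiTensor.map f g) h t) =
      BiTensor.map f (BiTensor.map g h) (BiTensor.assoc t) := by
  induction t using BiTensor.induction with
  | h w p =>
    induction w using BiTensor.induction with
    | h m n => rfl
    | ha x y hx hy => rw [BiTensor.mk_add_left]; simp only [map_add, hx, hy]
  | ha x y hx hy => simp only [map_add, hx, hy]

theorem freeCoaction_coassoc (t : Box k A H M) :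
    BiTensor.assoc (BiTensor.map (comulU k A H) LinearMap.id (freeCoaction k A H M t)) =
      BiTensor.map LinearMap.id (freeCoaction k A H M) (freeCoaction k A H M t) := by
  induction t using Box.induction with
  | ha x y hx hy => simp only [map_add, hx, hy]
  | h b m =>
    have e1 : comulU k A H ∘ₗ proj k A H =
        BiTensor.map (proj k A H) (proj k A H) ∘ₗ comul k A H :=
      LinearMap.ext (comulU_proj k A H)
    have e2 : freeCoaction k A H M ∘ₗ Box.incl m =
        BiTensor.map (proj k A H) (Box.incl m) ∘ₗ comul k A H :=
      LinearMap.ext fun b => freeCoaction_mk k A H b m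
    rw [freeCoaction_mk, BiTensor.map_map, BiTensor.map_map, e1, e2]
    have e3 := BiTensor.map_map (comul k A H) (LinearMap.id : H →ₗ[Env k A] H)
      (BiTensor.map (proj k A H) (proj k A H)) (Box.incl m) (comul k A H b)
    have e4 := BiTensor.map_map (LinearMap.id : H →ₗ[Env k A] H) (comul k A H)
      (proj k A H) (BiTensor.map (proj k A H) (Box.incl m)) (comul k A H b)
    rw [LinearMap.comp_id] at e3 e4
    rw [LinearMap.id_comp, LinearMap.id_comp, ← e3, ← e4, assoc_map]
    exact congrArg _ (Coring.coassoc b)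

theorem lid_map (f : M →ₗ[Env k A] N) (t : BiTensor k A A M) :
    BiTensor.lid (BiTensor.map LinearMap.id f t) = f (BiTensor.lid t) := by
  induction t using BiTensor.induction with
  | h a m =>
    rw [BiTensor.map_mk, BiTensor.lid_mk, BiTensor.lid_mk, map_smul]
    rfl
  | ha x y hx hy => simp only [map_add, hx, hy]

theorem freeCoaction_counit (t : Box k A H M) :
    BiTensor.lid (BiTensor.map (counitU k A H) LinearMap.id (freeCoaction k A H M t)) = t := by
  induction t using Box.induction with
  | ha x y hx hy => simp only [map_add, hx, hy]
  | h b m =>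
    have e1 : counitU k A H ∘ₗ proj k A H = counit k A H :=
      LinearMap.ext (counitU_proj k A H)
    rw [freeCoaction_mk, BiTensor.map_map, e1, LinearMap.id_comp]
    have e3 := BiTensor.map_map (counit k A H) (LinearMap.id : H →ₗ[Env k A] H)
      LinearMap.id (Box.incl m) (comul k A H b)
    rw [LinearMap.comp_id, LinearMap.id_comp] at e3
    rw [← e3, lid_map]
    exact congrArg (fun b => Box.mk b m) (Coring.counit_left b)

theorem evalAt_evalAt {M N : Type*} [AddCommGroup M] [Module (Env k A) M] [Module H M]
    [IsScalarTower (Env k A) H M] [AddCommGroup N] [Module (Env k A) N] [Module H N]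
    [IsScalarTower (Env k A) H N] (m : M) (n : N) (b : H) (t : BiTensor k A H H) :
    evalAt m n (diagAct b t) = diagAct b (evalAt m n t) := by
  induction t using BiTensor.induction with
  | ha x y hx hy => simp only [map_add, hx, hy]
  | h x y =>
    rw [evalAt_mk, diagAct_mk, diagAct_mk]
    generalize comul k A H b = t
    induction t using BiTensor.induction with
    | ha x y hx hy => simp only [map_add, hx, hy]
    | h u v => simp only [evalAt_mk, smul_eq_mul, mul_smul]

theorem diagAct_mul [IsBialgebroid k A H] {M N : Type*} [AddCommGroup M] [Module (Env k A) M]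
    [Module H M] [IsScalarTower (Env k A) H M] [AddCommGroup N] [Module (Env k A) N] [Module H N]
    [IsScalarTower (Env k A) H N] (b b' : H) (t : BiTensor k A M N) :
    diagAct (b * b') t = diagAct b (diagAct b' t) := by
  induction t using BiTensor.induction with
  | ha x y hx hy => simp only [map_add, hx, hy]
  | h m n => rw [diagAct_mk, IsBialgebroid.comul_mul, evalAt_evalAt, diagAct_mk]

theorem freeCoaction_smul [IsBialgebroid k A H] (b : H) (t : Box k A H M) :
    freeCoaction k A H M (b • t) = diagAct b (freeCoaction k A H M t) := by
  induction t using Box.induction with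
  | ha x y hx hy => simp only [smul_add, map_add, hx, hy]
  | h c m =>
    rw [Box.smul_mk, freeCoaction_mk', freeCoaction_mk', diagAct_mul]

theorem map_diagAct {M' N' : Type*} [AddCommGroup M'] [Module (Env k A) M'] [Module H M']
    [IsScalarTower (Env k A) H M'] [AddCommGroup N'] [Module (Env k A) N'] [Module H N']
    [IsScalarTower (Env k A) H N'] (b : H)
    (t : BiTensor k A M' N') :
    BiTensor.map (Box.ofModule M') (Box.ofModule N')
      (boxT₂ k A H M' N' (Box.mk b t)) = diagAct b t := by
  induction t using BiTensor.induction with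
  | ha x y hx hy => simp only [Box.mk_add_right, map_add, hx, hy]
  | h m n =>
    rw [boxT₂_mk_mk, diagAct_mk, BiTensor.map_map]
    generalize comul k A H b = t
    induction t using BiTensor.induction with
    | ha x y hx hy => simp only [map_add, hx, hy]
    | h u v => rfl

theorem map_fusionR {N' : Type*} [AddCommGroup N'] [Module (Env k A) N'] [Module H N']
    [IsScalarTower (Env k A) H N'] (b : H) (t : BiTensor k A (UnitCoalg k A H) N') :
    BiTensor.map LinearMap.id (Box.ofModule N') (fusionR k A H N' (Box.mk b t)) =
      diagAct b t := by
  rw [← map_diagAct, fusionR, LinearMap.comp_apply, BiTensor.map_map]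
  rfl

theorem freeCoaction_map (f : M →ₗ[Env k A] N) (t : Box k A H M) :
    BiTensor.map LinearMap.id (Box.map f) (freeCoaction k A H M t) =
      freeCoaction k A H N (Box.map f t) := by
  induction t using Box.induction with
  | ha x y hx hy => simp only [map_add, hx, hy]
  | h b m =>
    rw [Box.map_mk, freeCoaction_mk, freeCoaction_mk, BiTensor.map_map]
    rfl

end Comonoidal

/-! ## Hopf modules -/

section HopfModules

variable (k A H : Type u) [Field k] [Ring A] [Algebra k A] [Ring H] [Algebra k H] [EnvRing k A H]

/-- `H` is faithfully flat as a right `Aᵉ`-module: tensoring with `H` over `Aᵉ` preserves and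
reflects exactness of sequences of left `Aᵉ`-modules. -/
def IsFaithfullyFlat : Prop :=
  ∀ (M N P : Type u) [AddCommGroup M] [Module (Env k A) M] [AddCommGroup N]
    [Module (Env k A) N] [AddCommGroup P] [Module (Env k A) P] (f : M →ₗ[Env k A] N)
    (g : N →ₗ[Env k A] P),
    Function.Exact f g ↔
      Function.Exact (Box.map f : Box k A H M →ₗ[Env k A] Box k A H N) (Box.map g)

variable [Coring k A H]

/-- An `H`-module with a compatible `H ⊠ A`-coaction. The `A`-bimodule structure is the one induced
by the `H`-action. -/
structure HopfMod where
  carrier : Type u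
  [addCommGroup : AddCommGroup carrier]
  [bimodule : Module (Env k A) carrier]
  [module : Module H carrier]
  [isScalarTower : IsScalarTower (Env k A) H carrier]
  /-- the coaction `m ↦ m₍₋₁₎ ⊗ m₍₀₎` -/
  δ : carrier →ₗ[Env k A] BiTensor k A (UnitCoalg k A H) carrier
  coassoc : ∀ m, BiTensor.assoc (BiTensor.map (comulU k A H) LinearMap.id (δ m)) =
    BiTensor.map LinearMap.id δ (δ m)
  counit : ∀ m, BiTensor.lid (BiTensor.map (counitU k A H) LinearMap.id (δ m)) = m
  /-- `δ(h m) = h₁ m₍₋₁₎ ⊗ h₂ m₍₀₎` -/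
  compat : ∀ (h : H) m, δ (h • m) = diagAct h (δ m)

namespace HopfMod

attribute [instance] addCommGroup bimodule module isScalarTower

variable {k A H}

/-- Morphisms are the `H`-linear maps which commute with the coactions. -/
@[ext]
structure Hom (M N : HopfMod k A H) where
  toFun : M.carrier →ₗ[H] N.carrier
  comm : ∀ m, N.δ (toFun m) =
    BiTensor.map LinearMap.id (toFun.restrictScalars (Env k A)) (M.δ m)

instance : Category (HopfMod k A H) where
  Hom := Hom
  id M := ⟨LinearMap.id, fun m => by
    have h : ∀ t : BiTensor k A (UnitCoalg k A H) M.carrier,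
        BiTensor.map LinearMap.id LinearMap.id t = t := fun t => by
      induction t using BiTensor.induction with
      | h x y => rfl
      | ha x y hx hy => rw [map_add, hx, hy]
    exact (h _).symm⟩
  comp f g := ⟨g.toFun ∘ₗ f.toFun, fun m => by
    rw [LinearMap.comp_apply, g.comm, f.comm, BiTensor.map_map]
    rfl⟩

end HopfMod

/-- A left Hopf module over the bimonad `T = H ⊠ -`: a module `r : T M → M` over the monad `T` in
the category of `A`-bimodules, with a coaction `δ : M → T A ⊗ M` of the coalgebra `T A` in the
category of `A`-bimodules, such that `δ r = (T A ⊗ r) H^r_{A, M} (T δ)`. -/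
structure BimonadHopfMod where
  carrier : Type u
  [addCommGroup : AddCommGroup carrier]
  [bimodule : Module (Env k A) carrier]
  r : Box k A H carrier →ₗ[Env k A] carrier
  r_mul : r ∘ₗ Box.mul H carrier = r ∘ₗ Box.map r
  r_unit : r ∘ₗ Box.unit H = LinearMap.id
  δ : carrier →ₗ[Env k A] BiTensor k A (UnitCoalg k A H) carrier
  coassoc : ∀ m, BiTensor.assoc (BiTensor.map (comulU k A H) LinearMap.id (δ m)) =
    BiTensor.map LinearMap.id δ (δ m)
  counit : ∀ m, BiTensor.lid (BiTensor.map (counitU k A H) LinearMap.id (δ m)) = m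
  hopf : δ ∘ₗ r = BiTensor.map LinearMap.id r ∘ₗ fusionR k A H carrier ∘ₗ Box.map δ

namespace BimonadHopfMod

attribute [instance] addCommGroup bimodule

variable {k A H}

/-- Morphisms are the bimodule maps which commute with the actions and the coactions. -/
@[ext]
structure Hom (M N : BimonadHopfMod k A H) where
  toFun : M.carrier →ₗ[Env k A] N.carrier
  comm_r : ∀ t, toFun (M.r t) = N.r (Box.map toFun t)
  comm_δ : ∀ m, N.δ (toFun m) = BiTensor.map LinearMap.id toFun (M.δ m)

instance : Category (BimonadHopfMod k A H) where
  Hom := Hom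
  id M := ⟨LinearMap.id, fun t => by
      have h : ∀ t : Box k A H M.carrier, Box.map LinearMap.id t = t := fun t => by
        induction t using Box.induction with
        | h x y => rfl
        | ha x y hx hy => rw [map_add, hx, hy]
      rw [h]; rfl,
    fun m => by
      have h : ∀ t : BiTensor k A (UnitCoalg k A H) M.carrier,
          BiTensor.map LinearMap.id LinearMap.id t = t := fun t => by
        induction t using BiTensor.induction with
        | h x y => rfl
        | ha x y hx hy => rw [map_add, hx, hy]
      exact (h _).symm⟩
  comp f g := ⟨g.toFun ∘ₗ f.toFun, fun t => by
      rw [LinearMap.comp_apply, f.comm_r, g.comm_r]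
      congr 1
      induction t using Box.induction with
      | h x y => rfl
      | ha x y hx hy => rw [map_add, map_add, map_add, hx, hy],
    fun m => by
      rw [LinearMap.comp_apply, g.comm_δ, f.comm_δ, BiTensor.map_map]
      rfl⟩

end BimonadHopfMod

/-- The functor from `H`-modules with a compatible `H ⊠ A`-coaction to left Hopf modules over the
bimonad `H ⊠ -`. It keeps the bimodule and the coaction, and turns the action of `H` into the map
`h ⊠ m ↦ h m`. -/
def toBimonadHopfMod : HopfMod k A H ⥤ BimonadHopfMod k A H where
  obj M :=
    { carrier := M.carrier
      r := Box.ofModule M.carrier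
      r_mul := LinearMap.ext fun t => by
        induction t using Box.induction with
        | ha x y hx hy => rw [map_add, map_add, hx, hy]
        | h b t =>
          induction t using Box.induction with
          | ha x y hx hy => rw [Box.mk_add_right, map_add, map_add, hx, hy]
          | h c m => exact mul_smul b c m
      r_unit := LinearMap.ext fun m => one_smul H m
      δ := M.δ
      coassoc := M.coassoc
      counit := M.counit
      hopf := LinearMap.ext fun t => by
        induction t using Box.induction with
        | ha x y hx hy => rw [map_add, map_add, hx, hy]
        | h b m =>
          rw [LinearMap.comp_apply, LinearMap.comp_apply, LinearMap.comp_apply, Box.map_mk,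
            map_fusionR, ← M.compat]
          rfl }
  map f :=
    { toFun := f.toFun.restrictScalars (Env k A)
      comm_r := fun t => by
        induction t using Box.induction with
        | ha x y hx hy => simp only [map_add, hx, hy]
        | h b m => exact f.toFun.map_smul b m
      comm_δ := f.comm }

variable [IsBialgebroid k A H]

/-- The free functor `M ↦ H ⊠ M` from bimodules to `H`-modules with a compatible `H ⊠ A`-coaction:
`H ⊠ M` is the free `H`-module, with the coaction `h ⊠ m ↦ π(h₁) ⊗ (h₂ ⊠ m)`. -/
def freeHopfMod : ModuleCat.{u} (Env k A) ⥤ HopfMod k A H where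
  obj M :=
    { carrier := Box k A H M
      δ := freeCoaction k A H M
      coassoc := freeCoaction_coassoc
      counit := freeCoaction_counit
      compat := freeCoaction_smul }
  map f := ⟨Box.mapH f.hom, fun t => (freeCoaction_map f.hom t).symm⟩
  map_id M := HopfMod.Hom.ext (LinearMap.ext fun t => by
    induction t using Box.induction with
    | h x y => rfl
    | ha x y hx hy => rw [map_add, map_add, hx, hy])
  map_comp f g := HopfMod.Hom.ext (LinearMap.ext fun t => by
    induction t using Box.induction with
    | h x y => rfl
    | ha x y hx hy => rw [map_add, map_add, hx, hy])

/-- The free functor `M ↦ (T M, μ_M, T₂(A, M))` from bimodules to left Hopf modules over the bimonad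
`T = H ⊠ -`. -/
def freeBimonadHopfMod : ModuleCat.{u} (Env k A) ⥤ BimonadHopfMod k A H where
  obj M :=
    { carrier := Box k A H M
      r := Box.mul H M
      r_mul := ((toBimonadHopfMod k A H).obj ((freeHopfMod k A H).obj M)).r_mul
      r_unit := ((toBimonadHopfMod k A H).obj ((freeHopfMod k A H).obj M)).r_unit
      δ := boxT₂ k A H A M ∘ₗ Box.map BiTensor.lidInv
      coassoc := freeCoaction_coassoc
      counit := freeCoaction_counit
      hopf := ((toBimonadHopfMod k A H).obj ((freeHopfMod k A H).obj M)).hopf }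
  map f :=
    { toFun := Box.map f.hom
      comm_r := ((toBimonadHopfMod k A H).map ((freeHopfMod k A H).map f)).comm_r
      comm_δ := ((toBimonadHopfMod k A H).map ((freeHopfMod k A H).map f)).comm_δ }
  map_id M := (toBimonadHopfMod k A H).congr_map ((freeHopfMod k A H).map_id M)
  map_comp f g := (toBimonadHopfMod k A H).congr_map ((freeHopfMod k A H).map_comp f g)

end HopfModules

end HopfAlgebroids

/-!
Hopf modules over `T = H ⊠ -` are descent data along the `Aᵉ`-ring `H`.

The descent data are the `H`-modules `M` with an `H`-linear section `ρ : M → H ⊠ M` of the action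
such that `(H ⊠ ρ) ρ = (H ⊠ unit) ρ`, and when `H` is faithfully flat over `Aᵉ` these are equivalent
to `A`-bimodules: the bimodule corresponding to `(M, ρ)` is `{m | ρ m = 1 ⊠ m}`. The bridge between
the two notions is the natural map `θ : H ⊠ M → (H ⊠ A) ⊗ M`, `h ⊠ m ↦ π(h₁) ⊗ h₂ m`, defined for
every `H`-module `M` (`hopfMap`). It is bijective as soon as the Galois map `β` is
(`hopfMap_bijective`): the inverse sends `π(h) ⊗ m` to `∑ x ⊠ y m` where `β⁻¹(h ⊗ 1) = ∑ x ⊗ y`.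
Writing a Hopf module coaction as `δ = θ ρ` turns the compatibility of `δ` with the action into the
`H`-linearity of `ρ`, counitality into `ρ` being a section of the action, and coassociativity into
the cocycle condition (`HopfMod.descent_cocycle`).

Given this, flatness and the cocycle condition show that `ρ` identifies `M` with
`H ⊠ {m | ρ m = 1 ⊠ m}` (`HopfMod.counitMap_bijective`), so that the free functor is essentially
surjective. For the free module `H ⊠ N` one has `ρ = H ⊠ unit`, and faithful flatness shows that
`N` is the equalizer of `H ⊠ unit` and `unit` (`IsFaithfullyFlat.exact_unit`), because this
equalizer diagram becomes split after applying `H ⊠ -`. Hence the free functor is fully faithful.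

The two descriptions of Hopf modules agree because a module over the monad `H ⊠ -` is an `H`-module
whose bimodule structure is the one induced by `η`, and the compatibility conditions match by the
formula `map_fusionR` for the fusion operator.
-/

namespace HopfAlgebroids

section Box

variable {k A H : Type*} [Field k] [Ring A] [Algebra k A] [Ring H] [Algebra k H] [EnvRing k A H]
  {M N P : Type*} [AddCommGroup M] [Module (Env k A) M] [AddCommGroup N] [Module (Env k A) N]
  [AddCommGroup P] [Module (Env k A) P]

/-! ### The monad `H ⊠ -` -/

namespace Box

theorem map_id_apply (t : Box k A H M) : map LinearMap.id t = t := by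
  induction t using Box.induction with
  | h b m => rfl
  | ha x y hx hy => rw [map_add, hx, hy]

theorem map_comp_apply (f : M →ₗ[Env k A] N) (g : N →ₗ[Env k A] P) (t : Box k A H M) :
    map g (map f t) = map (g ∘ₗ f) t := by
  induction t using Box.induction with
  | h b m => rfl
  | ha x y hx hy => simp only [map_add, hx, hy]

theorem map_sub_apply (f g : M →ₗ[Env k A] N) (t : Box k A H M) :
    map (f - g) t = map f t - map g t := by
  induction t using Box.induction with
  | h b m =>
    have e := congrArg (Box.mk (k := k) (A := A) b) (sub_add_cancel (f m) (g m))
    rw [mk_add_right] at e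
    exact eq_sub_of_add_eq e
  | ha x y hx hy => simp only [map_add, hx, hy]; abel

theorem map_smulH (f : M →ₗ[Env k A] N) (h : H) (t : Box k A H M) : map f (h • t) = h • map f t :=
  (mapH f).map_smul h t

theorem mk_eq_smul_unit (h : H) (m : M) : (mk h m : Box k A H M) = h • unit H m := by
  rw [unit_apply, smul_mk, mul_one]

theorem ofModule_smulH [Module H M] [IsScalarTower (Env k A) H M] (h : H) (t : Box k A H M) :
    ofModule M (h • t) = h • ofModule M t := by
  induction t using Box.induction with
  | h b m => exact mul_smul h b m
  | ha x y hx hy => simp only [smul_add, map_add, hx, hy]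

theorem mul_map_unit (t : Box k A H M) : mul H M (map (unit H) t) = t := by
  induction t using Box.induction with
  | h b m => exact congrArg (mk · m) (mul_one b)
  | ha x y hx hy => rw [map_add, map_add, hx, hy]

theorem mul_map_map (f : M →ₗ[Env k A] N) (t : Box k A H (Box k A H M)) :
    mul H N (map (map f) t) = map f (mul H M t) := by
  induction t using Box.induction with
  | h b m => exact (map_smulH f b m).symm
  | ha x y hx hy => simp only [map_add, hx, hy]

theorem map_unit_injective :
    Function.Injective (map (unit H) : Box k A H M →ₗ[Env k A] Box k A H (Box k A H M)) :=
  Function.LeftInverse.injective mul_map_unit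

end Box

theorem BiTensor.map_id_apply (t : BiTensor k A M N) :
    BiTensor.map LinearMap.id LinearMap.id t = t := by
  induction t using BiTensor.induction with
  | h x y => rfl
  | ha x y hx hy => rw [map_add, hx, hy]

end Box

/-! ### Consequences of faithful flatness -/

section FaithfullyFlat

variable {k A H : Type u} [Field k] [Ring A] [Algebra k A] [Ring H] [Algebra k H] [EnvRing k A H]
  {M N : Type u} [AddCommGroup M] [Module (Env k A) M] [AddCommGroup N] [Module (Env k A) N]

theorem IsFaithfullyFlat.injective_iff (hf : IsFaithfullyFlat k A H) (f : M →ₗ[Env k A] N) :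
    Function.Injective f ↔
      Function.Injective (Box.map f : Box k A H M →ₗ[Env k A] Box k A H N) := by
  -- `f` is injective if and only if `0 → M → N` is exact, and `H ⊠ -` preserves the zero map
  have key := hf PUnit.{u + 1} M N 0 f
  have h0 : (Box.map (0 : PUnit.{u + 1} →ₗ[Env k A] M) :
      Box k A H PUnit.{u + 1} →ₗ[Env k A] Box k A H M) = 0 := by
    rw [← sub_self (0 : PUnit.{u + 1} →ₗ[Env k A] M)]
    exact LinearMap.ext fun t => by rw [Box.map_sub_apply, sub_self]; rfl
  rw [h0] at key
  have e : ∀ {X Y Z : Type u} [AddCommGroup X] [Module (Env k A) X] [AddCommGroup Y]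
      [Module (Env k A) Y] [AddCommGroup Z] [Module (Env k A) Z] (g : Y →ₗ[Env k A] Z),
      Function.Exact (0 : X →ₗ[Env k A] Y) g ↔ Function.Injective g := fun g => by
    rw [LinearMap.exact_iff, LinearMap.range_zero, LinearMap.ker_eq_bot]
  rwa [e, e] at key

theorem IsFaithfullyFlat.map_subtype_injective (hf : IsFaithfullyFlat k A H)
    (S : Submodule (Env k A) M) :
    Function.Injective (Box.map S.subtype : Box k A H S →ₗ[Env k A] Box k A H M) := by
  apply (hf.injective_iff (M := S) (N := M) S.subtype).1
  exact fun x y h => Subtype.ext h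

theorem IsFaithfullyFlat.exact_map_subtype (hf : IsFaithfullyFlat k A H)
    (f : M →ₗ[Env k A] N) {S : Submodule (Env k A) M} (hS : S = LinearMap.ker f) :
    Function.Exact (Box.map S.subtype : Box k A H S →ₗ[Env k A] Box k A H M)
      (Box.map f : Box k A H M →ₗ[Env k A] Box k A H N) := by
  subst hS
  apply (hf (LinearMap.ker f) M N (LinearMap.ker f).subtype f).1
  intro y
  exact ⟨fun hy => ⟨⟨y, hy⟩, rfl⟩, by rintro ⟨x, rfl⟩; exact x.2⟩

/-- After applying `H ⊠ -`, the unit is split by the multiplication of the monad. -/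
theorem IsFaithfullyFlat.unit_injective (hf : IsFaithfullyFlat k A H) :
    Function.Injective (Box.unit H : M →ₗ[Env k A] Box k A H M) :=
  (hf.injective_iff _).2 Box.map_unit_injective

/-- The equalizer property of `M → H ⊠ M ⇉ H ⊠ (H ⊠ M)`: after applying `H ⊠ -`, the multiplication
of the monad splits the diagram. -/
theorem IsFaithfullyFlat.exact_unit (hf : IsFaithfullyFlat k A H) :
    Function.Exact (Box.unit H : M →ₗ[Env k A] Box k A H M)
      (Box.map (Box.unit H) - Box.unit H :
        Box k A H M →ₗ[Env k A] Box k A H (Box k A H M)) := by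
  refine (hf _ _ _ _ _).2 fun x => ?_
  rw [Box.map_sub_apply, sub_eq_zero]
  constructor
  · intro hx
    refine ⟨Box.mul H M x, ?_⟩
    rw [← Box.mul_map_map, hx, Box.mul_map_unit]
  · rintro ⟨y, rfl⟩
    rw [Box.map_comp_apply, Box.map_comp_apply]
    rfl

end FaithfullyFlat

/-! ### The Hopf map `H ⊠ N → (H ⊠ A) ⊗ N` -/

section HopfMap

variable {k A H : Type*} [Field k] [Ring A] [Algebra k A] [Ring H] [Algebra k H] [EnvRing k A H]
  [Coring k A H]
  {M N : Type*} [AddCommGroup M] [Module (Env k A) M] [Module H M] [IsScalarTower (Env k A) H M]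
  [AddCommGroup N] [Module (Env k A) N] [Module H N] [IsScalarTower (Env k A) H N]

theorem map_diagAct_eq {M' N' : Type*} [AddCommGroup M'] [Module (Env k A) M'] [Module H M']
    [IsScalarTower (Env k A) H M'] [AddCommGroup N'] [Module (Env k A) N'] [Module H N']
    [IsScalarTower (Env k A) H N'] (f : M →ₗ[Env k A] M') (g : N →ₗ[Env k A] N')
    (hf : ∀ (h : H) m, f (h • m) = h • f m) (hg : ∀ (h : H) n, g (h • n) = h • g n) (h : H)
    (t : BiTensor k A M N) :
    BiTensor.map f g (diagAct h t) = diagAct h (BiTensor.map f g t) := by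
  induction t using BiTensor.induction with
  | ha x y hx hy => simp only [map_add, hx, hy]
  | h m n =>
    rw [BiTensor.map_mk, diagAct_mk, diagAct_mk]
    generalize comul k A H h = t
    induction t using BiTensor.induction with
    | ha x y hx hy => simp only [map_add, hx, hy]
    | h x y => rw [evalAt_mk, evalAt_mk, BiTensor.map_mk, hf, hg]

variable (N) in
/-- The natural map `H ⊠ N → (H ⊠ A) ⊗ N`, `h ⊠ n ↦ π(h₁) ⊗ h₂ n`, for an `H`-module `N`. -/
def hopfMap : Box k A H N →ₗ[Env k A] BiTensor k A (UnitCoalg k A H) N :=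
  BiTensor.map LinearMap.id (Box.ofModule N) ∘ₗ freeCoaction k A H N

theorem hopfMap_apply (t : Box k A H N) :
    hopfMap N t = BiTensor.map LinearMap.id (Box.ofModule N) (freeCoaction k A H N t) := rfl

theorem hopfMap_mk (h : H) (n : N) :
    hopfMap N (Box.mk h n : Box k A H N) = evalAt (Box.unit H 1) n (comul k A H h) := by
  rw [hopfMap_apply, freeCoaction_mk, BiTensor.map_map]
  generalize comul k A H h = t
  induction t using BiTensor.induction with
  | ha x y hx hy => simp only [map_add, hx, hy]
  | h x y =>
    rw [evalAt_mk, Box.unit_apply, Box.smul_mk, mul_one]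
    rfl

theorem hopfMap_smul [IsBialgebroid k A H] (h : H) (t : Box k A H N) :
    hopfMap N (h • t) = diagAct h (hopfMap N t) := by
  rw [hopfMap_apply, freeCoaction_smul, hopfMap_apply,
    map_diagAct_eq _ _ (fun _ _ => rfl) Box.ofModule_smulH]

theorem hopfMap_unit [IsBialgebroid k A H] (n : N) :
    hopfMap N (Box.unit H n : Box k A H N) = BiTensor.mk (Box.unit H (1 : A)) n := by
  rw [Box.unit_apply, hopfMap_mk, IsBialgebroid.comul_one, evalAt_mk, one_smul, one_smul]

theorem lid_hopfMap (t : Box k A H N) :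
    BiTensor.lid (BiTensor.map (counitU k A H) LinearMap.id (hopfMap N t)) =
      Box.ofModule N t := by
  have e := BiTensor.map_map (counitU k A H) LinearMap.id LinearMap.id (Box.ofModule N)
    (freeCoaction k A H N t)
  rw [LinearMap.id_comp, LinearMap.comp_id] at e
  rw [hopfMap_apply, BiTensor.map_map, LinearMap.id_comp, LinearMap.comp_id, ← e, lid_map,
    freeCoaction_counit]

theorem hopfMap_naturality (f : M →ₗ[Env k A] N) (hf : ∀ (h : H) m, f (h • m) = h • f m)
    (t : Box k A H M) :
    hopfMap N (Box.map f t) = BiTensor.map LinearMap.id f (hopfMap M t) := by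
  have e : Box.ofModule N ∘ₗ Box.map f = f ∘ₗ (Box.ofModule M : Box k A H M →ₗ[Env k A] M) :=
    LinearMap.ext fun t => by
      induction t using Box.induction with
      | h b m => exact (hf b m).symm
      | ha x y hx hy => rw [map_add, map_add, hx, hy]
  rw [hopfMap_apply, ← freeCoaction_map, BiTensor.map_map, hopfMap_apply, BiTensor.map_map, e]

theorem hopfMap_map_unit {P : Type*} [AddCommGroup P] [Module (Env k A) P] (t : Box k A H P) :
    hopfMap (Box k A H P) (Box.map (Box.unit H) t) = freeCoaction k A H P t := by
  rw [hopfMap_apply, ← freeCoaction_map, BiTensor.map_map, LinearMap.id_comp]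
  have e : (Box.ofModule (Box k A H P) ∘ₗ Box.map (Box.unit H) :
      Box k A H P →ₗ[Env k A] Box k A H P) = LinearMap.id := LinearMap.ext Box.mul_map_unit
  rw [e, BiTensor.map_id_apply]

/-- Under `hopfMap`, the comultiplication of `H ⊠ A` corresponds to the map `H ⊠ unit`, which is the
comultiplication of the comonad `H ⊠ -` on `H`-modules. -/
theorem assoc_comulU_hopfMap (t : Box k A H N) :
    BiTensor.assoc (BiTensor.map (comulU k A H) LinearMap.id (hopfMap N t)) =
      BiTensor.map LinearMap.id (hopfMap N) (hopfMap _ (Box.map (Box.unit H) t)) := by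
  have e := BiTensor.map_map (comulU k A H) LinearMap.id
    (BiTensor.map LinearMap.id LinearMap.id) (Box.ofModule N) (freeCoaction k A H N t)
  have e' : (BiTensor.map LinearMap.id LinearMap.id : BiTensor k A (UnitCoalg k A H)
      (UnitCoalg k A H) →ₗ[Env k A] _) = LinearMap.id := LinearMap.ext BiTensor.map_id_apply
  rw [e', LinearMap.id_comp, LinearMap.comp_id] at e
  rw [hopfMap_map_unit, hopfMap_apply, BiTensor.map_map, LinearMap.id_comp, LinearMap.comp_id, ← e,
    ← e', assoc_map, freeCoaction_coassoc, BiTensor.map_map]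
  rfl

end HopfMap

/-! ### Bijectivity of the Hopf map -/

section Bijectivity

/-- The inverse of a bijective homomorphism of abelian groups. -/
noncomputable def bijectiveInv {X Y : Type*} [AddCommGroup X] [AddCommGroup Y] (f : X →+ Y)
    (hf : Function.Bijective f) : Y →+ X :=
  (AddEquiv.ofBijective f hf).symm.toAddMonoidHom

theorem bijectiveInv_apply_apply {X Y : Type*} [AddCommGroup X] [AddCommGroup Y] (f : X →+ Y)
    (hf : Function.Bijective f) (x : X) : bijectiveInv f hf (f x) = x :=
  (AddEquiv.ofBijective f hf).symm_apply_apply x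

variable {k A H : Type*} [Field k] [Ring A] [Algebra k A] [Ring H] [Algebra k H] [EnvRing k A H]
  {N : Type*} [AddCommGroup N] [Module (Env k A) N] [Module H N] [IsScalarTower (Env k A) H N]

theorem mulRight_mulRight (x y x' y' : H) (t : BiTensor k A H H) :
    mulRight x y (mulRight x' y' t) = mulRight (x' * x) (y' * y) t := by
  induction t using BiTensor.induction with
  | h b b' => simp only [mulRight_mk, mul_assoc]
  | ha x y hx hy => simp only [map_add, hx, hy]

variable (k A H) in
/-- The source `H ⊗_{Aᵒᵖ} H` of the Galois map `β`. -/
abbrev BetaSource : Type _ :=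
  Balanced (fun (a : A) (b : H) => b * tgt k H a) (fun (a : A) (b : H) => tgt k H a * b)

/-- The element `x ⊗ y` of `H ⊗_{Aᵒᵖ} H`. -/
def BetaSource.mk (x y : H) : BetaSource k A H :=
  Balanced.mk (fun (a : A) (b : H) => b * tgt k H a) (fun (a : A) (b : H) => tgt k H a * b) x y

/-- The map `H ⊗_{Aᵒᵖ} H → H ⊠ N`, `x ⊗ y ↦ x ⊠ y n`. -/
def boxEval (n : N) : BetaSource k A H →+ Box k A H N :=
  Balanced.lift
    (Balanced.mkHom₂ (fun x y => Box.mk x (y • n)) (fun _ _ _ => Box.mk_add_left _ _ _)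
      (fun x y y' => by rw [add_smul, Box.mk_add_right]))
    (fun a x y => by
      rw [Balanced.mkHom₂_apply, Balanced.mkHom₂_apply, tgt, Box.mk_bal, mul_smul, η_smul])

theorem boxEval_mk (n : N) (x y : H) :
    boxEval n (BetaSource.mk x y : BetaSource k A H) = Box.mk x (y • n) :=
  Balanced.lift_mk _ _ _ _

variable [Coring k A H]

theorem galoisβ_mk (x y : H) :
    galoisβ k A H (BetaSource.mk x y) = mulRight 1 y (comul k A H x) := by
  unfold galoisβ BetaSource.mk
  rw [Balanced.lift_mk, Balanced.mkHom₂_apply]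

/-- Since `β` is surjective, `H ⊗_A H` is generated by the elements `x₁ ⊗ x₂ y`. -/
theorem galois_induction (hβ : Function.Bijective (galoisβ k A H)) {p : BiTensor k A H H → Prop}
    (h : ∀ x y, p (mulRight 1 y (comul k A H x))) (ha : ∀ x y, p x → p y → p (x + y))
    (z : BiTensor k A H H) : p z := by
  obtain ⟨w, rfl⟩ := hβ.2 z
  induction w using Balanced.induction with
  | h x y =>
    have := h x y
    rw [← galoisβ_mk] at this
    exact this
  | ha x y hx hy =>
    rw [map_add]
    exact ha _ _ hx hy

/-- The map `H ⊗_A H → H ⊠ N` sending `h ⊗ h'` to `∑ x ⊠ y n`, where `β⁻¹(h ⊗ h') = ∑ x ⊗ y`. -/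
noncomputable def galoisEval (hβ : Function.Bijective (galoisβ k A H)) (n : N) :
    BiTensor k A H H →+ Box k A H N :=
  (boxEval n).comp (bijectiveInv (galoisβ k A H) hβ)

variable (hβ : Function.Bijective (galoisβ k A H))

theorem galoisEval_galoisβ (n : N) (w : BetaSource k A H) :
    galoisEval hβ n (galoisβ k A H w) = boxEval n w := by
  unfold galoisEval
  rw [AddMonoidHom.comp_apply, bijectiveInv_apply_apply]

theorem galoisEval_comul (n : N) (x y : H) :
    galoisEval hβ n (mulRight 1 y (comul k A H x)) = Box.mk x (y • n) := by
  rw [← galoisβ_mk, galoisEval_galoisβ, boxEval_mk]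

theorem galoisEval_add (n n' : N) (z : BiTensor k A H H) :
    galoisEval hβ (n + n') z = galoisEval hβ n z + galoisEval hβ n' z := by
  induction z using galois_induction hβ with
  | h x y => simp only [galoisEval_comul, smul_add, Box.mk_add_right]
  | ha x y hx hy => simp only [map_add, hx, hy]; abel

theorem galoisEval_mulRight_one (n : N) (b : H) (z : BiTensor k A H H) :
    galoisEval hβ n (mulRight 1 b z) = galoisEval hβ (b • n) z := by
  induction z using galois_induction hβ with
  | h x y => rw [mulRight_mulRight, one_mul, galoisEval_comul, galoisEval_comul, mul_smul]
  | ha x y hx hy => simp only [map_add, hx, hy]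

theorem galoisEval_mk (n : N) (x y : H) :
    galoisEval hβ n (BiTensor.mk x y) = galoisEval hβ (y • n) (BiTensor.mk x 1) := by
  rw [← galoisEval_mulRight_one, mulRight_mk, mul_one, one_mul]

/-- `galoisEval` factors through `H ⊠ A` in the first variable. In terms of `β⁻¹(h ⊗ h') = ∑ x ⊗ y`,
both sides are `∑ x ⊠ s(a) y n`: the left one because `β (x s(a) ⊗ y) = x₁ s(a) ⊗ x₂ y`, the right
one because `x₁ t(a) ⊗ x₂ = x₁ ⊗ x₂ s(a)`. -/
theorem galoisEval_src (n : N) (a : A) (z : BiTensor k A H H) :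
    galoisEval hβ n (mulRight (src k H a) 1 z) = galoisEval hβ n (mulRight (tgt k H a) 1 z) := by
  induction z using galois_induction hβ with
  | ha x y hx hy => simp only [map_add, hx, hy]
  | h x y =>
    have e1 : mulRight (src k H a) 1 (mulRight 1 y (comul k A H x)) =
        mulRight 1 y (comul k A H (x * src k H a)) := by
      rw [comul_mul_src, mulRight_mulRight, mulRight_mulRight, one_mul, one_mul, mul_one, mul_one]
    have e2 : mulRight (tgt k H a) 1 (mulRight 1 y (comul k A H x)) =
        mulRight 1 (src k H a * y) (comul k A H x) := by
      have := congrArg (mulRight 1 y) (takeuchi (k := k) a x)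
      rw [mulRight_mulRight, mulRight_mulRight, mul_one, one_mul] at this
      rw [mulRight_mulRight, one_mul, mul_one, this, mul_one]
    rw [e1, e2, galoisEval_comul, galoisEval_comul, src, Box.mk_bal, mul_smul, η_smul]

theorem galoisEval_src_mk (n : N) (a : A) (x y : H) :
    galoisEval hβ n (BiTensor.mk (x * src k H a) y) =
      galoisEval hβ n (BiTensor.mk (x * tgt k H a) y) := by
  simpa only [mulRight_mk, mul_one] using galoisEval_src hβ n a (BiTensor.mk x y)

/-- The map `H ⊠ A → H ⊠ N`, `h ⊠ a ↦ ∑ x ⊠ y n`, where `β⁻¹(h s(a) ⊗ 1) = ∑ x ⊗ y`. -/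
noncomputable def hopfInvAux (n : N) : UnitCoalg k A H →+ Box k A H N :=
  Box.lift (fun h a => galoisEval hβ n (BiTensor.mk (h * src k H a) 1))
    (fun h h' a => by rw [add_mul, BiTensor.mk_add_left, map_add])
    (fun h a a' => by
      rw [src, el_add, map_add, mul_add, BiTensor.mk_add_left, map_add]
      rfl)
    (fun x h a => by
      induction x using env_induction with
      | h c d =>
        have h1 : h * EnvRing.η (el k c * er k d) * src k H a =
            h * src k H c * src k H a * tgt k H d := by
          rw [mul_assoc, src, src, tgt, ← map_mul, mul_assoc (el k c), ← el_mul_er, map_mul,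
            map_mul]
          simp only [mul_assoc]
        have h2 : h * src k H ((el k c * er k d) • a) =
            h * src k H c * src k H a * src k H d := by
          rw [mul_smul, er_smul, el_smul, src, el_mul, el_mul, map_mul, map_mul]
          simp only [mul_assoc]
          rfl
        rw [h1, h2, galoisEval_src_mk]
      | ha x y hx hy =>
        have e : src k H (x • a + y • a) = src k H (x • a) + src k H (y • a) := by
          rw [src, el_add, map_add]; rfl
        rw [map_add, mul_add, add_mul, BiTensor.mk_add_left, map_add, hx, hy, add_smul, e, mul_add,
          BiTensor.mk_add_left, map_add])

theorem hopfInvAux_mk (n : N) (h : H) (a : A) :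
    hopfInvAux hβ n (Box.mk h a) = galoisEval hβ n (BiTensor.mk (h * src k H a) 1) :=
  Box.lift_mk _ _ _ _ _ _

variable (N) in
/-- The inverse `π(h) ⊗ n ↦ ∑ x ⊠ y n` of the Hopf map, where `β⁻¹(h ⊗ 1) = ∑ x ⊗ y`. -/
noncomputable def hopfInv : BiTensor k A (UnitCoalg k A H) N →+ Box k A H N :=
  BiTensor.lift (fun u n => hopfInvAux hβ n u) (fun _ _ _ => map_add _ _ _)
    (fun u n n' => by
      induction u using Box.induction with
      | h b a => simp only [hopfInvAux_mk, galoisEval_add]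
      | ha x y hx hy => simp only [map_add, hx, hy]; abel)
    (fun a u n => by
      induction u using Box.induction with
      | h b c =>
        -- both sides are the value of `galoisEval` at `b s(c) ⊗ s(a) = t(a) b s(c) ⊗ 1`
        have e := galoisEval_mk hβ n (b * src k H c) (src k H a)
        rw [src_smul] at e
        rw [Box.env_smul, Box.smul_mk, hopfInvAux_mk, hopfInvAux_mk, ← e, mul_assoc]
        have e' := BiTensor.mk_bal (k := k) a (b * src k H c) (1 : H)
        rw [er_smul_eq, el_smul_eq, mul_one] at e'
        rw [← e']
        rfl
      | ha x y hx hy => simp only [smul_add, map_add, hx, hy])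

theorem hopfInv_mk (u : UnitCoalg k A H) (n : N) :
    hopfInv N hβ (BiTensor.mk u n) = hopfInvAux hβ n u :=
  BiTensor.lift_mk _ _ _ _ _ _

theorem hopfInv_evalAt (n : N) (z : BiTensor k A H H) :
    hopfInv N hβ (evalAt (Box.unit H (1 : A)) n z) = galoisEval hβ n z := by
  induction z using BiTensor.induction with
  | h x y =>
    rw [evalAt_mk, hopfInv_mk, Box.unit_apply, Box.smul_mk, mul_one, hopfInvAux_mk, src_one,
      mul_one, ← galoisEval_mk]
  | ha x y hx hy => simp only [map_add, hx, hy]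

theorem hopfInv_hopfMap (t : Box k A H N) : hopfInv N hβ (hopfMap N t) = t := by
  induction t using Box.induction with
  | h b n =>
    have e := galoisEval_comul hβ n b 1
    have e' : ∀ z : BiTensor k A H H, mulRight 1 1 z = z := fun z => by
      induction z using BiTensor.induction with
      | h x y => rw [mulRight_mk, mul_one, mul_one]
      | ha x y hx hy => rw [map_add, hx, hy]
    rw [hopfMap_mk, hopfInv_evalAt, ← e' (comul k A H b), e, one_smul]
  | ha x y hx hy => rw [map_add, map_add, hx, hy]

theorem hopfMap_galoisEval (n : N) (z : BiTensor k A H H) :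
    hopfMap N (galoisEval hβ n z) = evalAt (Box.unit H (1 : A)) n z := by
  induction z using galois_induction hβ with
  | h x y => rw [galoisEval_comul, hopfMap_mk, evalAt_mulRight, one_smul]
  | ha x y hx hy => simp only [map_add, hx, hy]

variable (N) in
/-- The Hopf map is bijective when the Galois map `β` is, with inverse `hopfInv`. -/
theorem hopfMap_bijective (hβ : Function.Bijective (galoisβ k A H)) :
    Function.Bijective (hopfMap N : Box k A H N →ₗ[Env k A] _) := by
  refine ⟨Function.LeftInverse.injective (hopfInv_hopfMap hβ), fun w => ?_⟩
  induction w using BiTensor.induction with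
  | h u n =>
    induction u using Box.induction with
    | h b a =>
      refine ⟨galoisEval hβ n (BiTensor.mk (b * src k H a) 1), ?_⟩
      rw [hopfMap_galoisEval, evalAt_mk, one_smul, Box.unit_apply, Box.smul_mk, mul_one, src,
        Box.mk_bal, el_smul, mul_one]
    | ha x y hx hy =>
      obtain ⟨x', hx⟩ := hx
      obtain ⟨y', hy⟩ := hy
      exact ⟨x' + y', by rw [map_add, hx, hy, BiTensor.mk_add_left]⟩
  | ha x y hx hy =>
    obtain ⟨x', rfl⟩ := hx
    obtain ⟨y', rfl⟩ := hy
    exact ⟨x' + y', map_add _ _ _⟩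

end Bijectivity

/-! ### The descent datum of a Hopf module -/

section Descent

variable {k A H : Type u} [Field k] [Ring A] [Algebra k A] [Ring H] [Algebra k H] [EnvRing k A H]
  [Coring k A H]

/-- The Hopf map as an isomorphism of bimodules. -/
noncomputable def hopfEquiv (hβ : Function.Bijective (galoisβ k A H)) (N : Type u) [AddCommGroup N]
    [Module (Env k A) N] [Module H N] [IsScalarTower (Env k A) H N] :
    Box k A H N ≃ₗ[Env k A] BiTensor k A (UnitCoalg k A H) N :=
  LinearEquiv.ofBijective (hopfMap N) (hopfMap_bijective N hβ)

theorem map_hopfMap_injective (hβ : Function.Bijective (galoisβ k A H)) (C N : Type u)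
    [AddCommGroup C] [Module (Env k A) C] [AddCommGroup N]
    [Module (Env k A) N] [Module H N] [IsScalarTower (Env k A) H N] :
    Function.Injective (BiTensor.map (LinearMap.id : C →ₗ[Env k A] C)
      (hopfMap N : Box k A H N →ₗ[Env k A] _)) := by
  refine Function.LeftInverse.injective
    (g := BiTensor.map LinearMap.id (hopfEquiv hβ N).symm.toLinearMap) fun t => ?_
  have e : (hopfEquiv hβ N).symm.toLinearMap ∘ₗ hopfMap N = LinearMap.id :=
    LinearMap.ext (hopfEquiv hβ N).symm_apply_apply
  rw [BiTensor.map_map, e, LinearMap.id_comp, BiTensor.map_id_apply]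

namespace HopfMod

variable (hβ : Function.Bijective (galoisβ k A H)) (M : HopfMod k A H)

/-- The descent datum `ρ : M → H ⊠ M` of a Hopf module, the coaction followed by the inverse of the
Hopf map. -/
noncomputable def descent : M.carrier →ₗ[Env k A] Box k A H M.carrier :=
  (hopfEquiv hβ M.carrier).symm.toLinearMap ∘ₗ M.δ

theorem hopfMap_descent (m : M.carrier) : hopfMap M.carrier (M.descent hβ m) = M.δ m :=
  (hopfEquiv hβ M.carrier).apply_symm_apply (M.δ m)

/-- Counitality of the coaction, in terms of the descent datum. -/
theorem ofModule_descent (m : M.carrier) : Box.ofModule M.carrier (M.descent hβ m) = m := by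
  rw [← lid_hopfMap, hopfMap_descent, M.counit]

/-- The bimodule of coinvariants `{m | ρ m = 1 ⊠ m}` of a Hopf module. -/
noncomputable def coinvariants : Submodule (Env k A) M.carrier :=
  LinearMap.ker (M.descent hβ - Box.unit H)

theorem descent_coinvariant (m : M.coinvariants hβ) : M.descent hβ m = Box.unit H (m : M.carrier) :=
  sub_eq_zero.1 m.2

/-- The `H`-linear map `H ⊠ {m | ρ m = 1 ⊠ m} → M`, `h ⊠ m ↦ h m`. -/
noncomputable def counitMap : Box k A H (M.coinvariants hβ) →ₗ[H] M.carrier where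
  toFun t := Box.ofModule M.carrier (Box.map (M.coinvariants hβ).subtype t)
  map_add' x y := by rw [map_add, map_add]
  map_smul' h t := by rw [Box.map_smulH, Box.ofModule_smulH]; rfl

theorem counitMap_apply (t : Box k A H (M.coinvariants hβ)) :
    M.counitMap hβ t = Box.ofModule M.carrier (Box.map (M.coinvariants hβ).subtype t) := rfl

theorem counitMap_mk (h : H) (m : M.coinvariants hβ) :
    M.counitMap hβ (Box.mk h m) = h • (m : M.carrier) := rfl

variable [IsBialgebroid k A H]

/-- Compatibility of the coaction with the action, in terms of the descent datum. -/
theorem descent_smul (h : H) (m : M.carrier) : M.descent hβ (h • m) = h • M.descent hβ m := by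
  apply (hopfMap_bijective M.carrier hβ).1
  rw [hopfMap_descent, hopfMap_smul, hopfMap_descent, M.compat]

/-- Coassociativity of the coaction, in terms of the descent datum. -/
theorem descent_cocycle (m : M.carrier) :
    Box.map (M.descent hβ) (M.descent hβ m) = Box.map (Box.unit H) (M.descent hβ m) := by
  -- compare the two sides after the injection `H ⊠ (H ⊠ M) → (H ⊠ A) ⊗ ((H ⊠ A) ⊗ M)` given by two
  -- Hopf maps, where they become the two sides of the coassociativity axiom
  apply (hopfMap_bijective (Box k A H M.carrier) hβ).1
  apply map_hopfMap_injective hβ (UnitCoalg k A H) M.carrier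
  have e : hopfMap M.carrier ∘ₗ M.descent hβ = M.δ := LinearMap.ext (M.hopfMap_descent hβ)
  rw [← assoc_comulU_hopfMap, hopfMap_descent, M.coassoc,
    hopfMap_naturality (M.descent hβ) (M.descent_smul hβ), BiTensor.map_map, hopfMap_descent, e,
    LinearMap.id_comp]

theorem descent_counitMap (t : Box k A H (M.coinvariants hβ)) :
    M.descent hβ (M.counitMap hβ t) = Box.map (M.coinvariants hβ).subtype t := by
  induction t using Box.induction with
  | h b m =>
    rw [counitMap_mk, descent_smul, descent_coinvariant, ← Box.mk_eq_smul_unit]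
    rfl
  | ha x y hx hy => simp only [map_add, hx, hy]

/-- `counitMap` commutes with the coactions. -/
theorem δ_counitMap (t : Box k A H (M.coinvariants hβ)) :
    M.δ (M.counitMap hβ t) = BiTensor.map LinearMap.id
      ((M.counitMap hβ).restrictScalars (Env k A)) (freeCoaction k A H _ t) := by
  rw [← hopfMap_descent hβ, descent_counitMap, hopfMap_apply, ← freeCoaction_map, BiTensor.map_map]
  rfl

/-- The coinvariants generate: `M` is isomorphic to `H ⊠ {m | ρ m = 1 ⊠ m}`. Injectivity uses that
`H ⊠ -` preserves injections, surjectivity that it preserves the kernel of `ρ - unit`, in which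
`ρ m` lies by the cocycle condition. -/
theorem counitMap_bijective (hf : IsFaithfullyFlat k A H) :
    Function.Bijective (M.counitMap hβ) := by
  have hinj := hf.map_subtype_injective (M.coinvariants hβ)
  constructor
  · intro x y hxy
    apply hinj
    rw [← descent_counitMap, hxy, descent_counitMap]
  · intro m
    have hex := hf.exact_map_subtype (M.descent hβ - Box.unit H)
      (S := M.coinvariants hβ) rfl
    obtain ⟨t, ht⟩ := (hex (M.descent hβ m)).1
      (by rw [Box.map_sub_apply, descent_cocycle, sub_self])
    exact ⟨t, by rw [counitMap_apply, ht, ofModule_descent]⟩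

/-- A bijective morphism of Hopf modules is an isomorphism. -/
noncomputable def isoOfBijective {M N : HopfMod k A H} (f : Hom M N)
    (hf : Function.Bijective f.toFun) : M ≅ N where
  hom := f
  inv :=
    { toFun := (LinearEquiv.ofBijective f.toFun hf).symm.toLinearMap
      comm := fun n => by
        obtain ⟨m, rfl⟩ := hf.2 n
        have e : (LinearEquiv.ofBijective f.toFun hf).symm.toLinearMap.restrictScalars (Env k A) ∘ₗ
            f.toFun.restrictScalars (Env k A) = LinearMap.id :=
          LinearMap.ext (LinearEquiv.ofBijective f.toFun hf).symm_apply_apply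
        rw [f.comm, BiTensor.map_map, e, LinearMap.id_comp, BiTensor.map_id_apply]
        exact congrArg M.δ ((LinearEquiv.ofBijective f.toFun hf).symm_apply_apply m) }
  hom_inv_id := Hom.ext (LinearMap.ext (LinearEquiv.ofBijective f.toFun hf).symm_apply_apply)
  inv_hom_id := Hom.ext (LinearMap.ext (LinearEquiv.ofBijective f.toFun hf).apply_symm_apply)

end HopfMod

end Descent

/-! ### The equivalences -/

section Equivalences

variable {k A H : Type u} [Field k] [Ring A] [Algebra k A] [Ring H] [Algebra k H] [EnvRing k A H]
  [Coring k A H]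

/-- The module with a compatible coaction underlying a left Hopf module over the bimonad `H ⊠ -`,
with `h m = r (h ⊠ m)`. -/
def BimonadHopfMod.toHopfMod (X : BimonadHopfMod k A H) : HopfMod k A H :=
  letI : Module H X.carrier :=
    { smul := fun h m => X.r (Box.mk h m)
      one_smul := fun m => LinearMap.congr_fun X.r_unit m
      mul_smul := fun h h' m => LinearMap.congr_fun X.r_mul (Box.mk h (Box.mk h' m))
      smul_zero := fun h => by
        change X.r (Box.mk h 0) = 0
        have := Box.mk_add_right (k := k) (A := A) h (0 : X.carrier) 0
        rw [add_zero, left_eq_add] at this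
        rw [this, map_zero]
      smul_add := fun h m m' => by
        change X.r (Box.mk h (m + m')) = X.r (Box.mk h m) + X.r (Box.mk h m')
        rw [Box.mk_add_right, map_add]
      add_smul := fun h h' m => by
        change X.r (Box.mk (h + h') m) = X.r (Box.mk h m) + X.r (Box.mk h' m)
        rw [Box.mk_add_left, map_add]
      zero_smul := fun m => by
        change X.r (Box.mk 0 m) = 0
        have := Box.mk_add_left (k := k) (A := A) (0 : H) 0 m
        rw [add_zero, left_eq_add] at this
        rw [this, map_zero] }
  haveI : IsScalarTower (Env k A) H X.carrier :=
    ⟨fun x h m => X.r.map_smul x (Box.mk h m)⟩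
  { carrier := X.carrier
    δ := X.δ
    coassoc := X.coassoc
    counit := X.counit
    compat := fun h m => by
      have e : (Box.ofModule X.carrier : Box k A H X.carrier →ₗ[Env k A] _) = X.r :=
        LinearMap.ext fun t => by
          induction t using Box.induction with
          | h b m => rfl
          | ha x y hx hy => rw [map_add, map_add, hx, hy]
      rw [← map_fusionR, e]
      exact LinearMap.congr_fun X.hopf (Box.mk h m) }

theorem BimonadHopfMod.toHopfMod_r (X : BimonadHopfMod k A H) (t : Box k A H X.carrier) :
    ((toBimonadHopfMod k A H).obj X.toHopfMod).r t = X.r t := by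
  induction t using Box.induction with
  | h b m => rfl
  | ha x y hx hy => exact (map_add _ x y).trans ((congrArg₂ _ hx hy).trans (map_add _ x y).symm)

/-- The identity of the underlying bimodule, as an isomorphism of Hopf modules. -/
def BimonadHopfMod.toHopfModIso (X : BimonadHopfMod k A H) :
    (toBimonadHopfMod k A H).obj X.toHopfMod ≅ X where
  hom :=
    { toFun := LinearMap.id
      comm_r := fun t => (X.toHopfMod_r t).trans (congrArg X.r (Box.map_id_apply t).symm)
      comm_δ := fun m => (BiTensor.map_id_apply (X.δ m)).symm }
  inv :=
    { toFun := LinearMap.id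
      comm_r := fun t => (X.toHopfMod_r t).symm.trans
        (congrArg ((toBimonadHopfMod k A H).obj X.toHopfMod).r (Box.map_id_apply t).symm)
      comm_δ := fun m => (BiTensor.map_id_apply (X.δ m)).symm }
  hom_inv_id := rfl
  inv_hom_id := rfl

theorem toBimonadHopfMod_isEquivalence : (toBimonadHopfMod k A H).IsEquivalence where
  faithful := ⟨fun hfg => HopfMod.Hom.ext (LinearMap.ext fun m =>
    LinearMap.congr_fun (congrArg BimonadHopfMod.Hom.toFun hfg) m)⟩
  full := ⟨fun f =>
    ⟨({ toFun :=
          { toFun := f.toFun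
            map_add' := f.toFun.map_add
            map_smul' := fun h m => f.comm_r (Box.mk h m) }
        comm := f.comm_δ } : HopfMod.Hom _ _), rfl⟩⟩
  essSurj := ⟨fun X => ⟨X.toHopfMod, ⟨X.toHopfModIso⟩⟩⟩

variable [IsBialgebroid k A H]

/-- Both functors send `N` to `H ⊠ N` with the same action and coaction, so that the components of
the isomorphism are identities. -/
def freeCompIso : freeHopfMod k A H ⋙ toBimonadHopfMod k A H ≅ freeBimonadHopfMod k A H :=
  Iso.refl _

/-- The coinvariant elements of a free Hopf module `H ⊠ N` come from `N`. Under the Hopf map,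
coinvariance says that `H ⊠ unit` and `unit` agree on `t`. -/
theorem exists_unit_eq_of_freeCoaction (hβ : Function.Bijective (galoisβ k A H))
    (hf : IsFaithfullyFlat k A H) {N : Type u} [AddCommGroup N] [Module (Env k A) N]
    (t : Box k A H N)
    (ht : freeCoaction k A H N t = BiTensor.mk (Box.unit H (1 : A)) t) :
    ∃ n, Box.unit H n = t := by
  refine (hf.exact_unit t).1 (sub_eq_zero.2 ?_)
  apply (hopfMap_bijective (Box k A H N) hβ).1
  rw [hopfMap_map_unit, hopfMap_unit, ht]

theorem freeCoaction_unit {N : Type u} [AddCommGroup N] [Module (Env k A) N] (n : N) :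
    freeCoaction k A H N (Box.unit H n) = BiTensor.mk (Box.unit H (1 : A)) (Box.unit H n) := by
  rw [← hopfMap_map_unit, Box.unit_apply, Box.map_mk, ← Box.unit_apply, hopfMap_unit]
  rfl

theorem freeHopfMod_full (hβ : Function.Bijective (galoisβ k A H)) (hf : IsFaithfullyFlat k A H) :
    (freeHopfMod k A H).Full := by
  refine ⟨fun {N N'} φ => ?_⟩
  -- morphisms of Hopf modules preserve coinvariants, hence `φ` maps `1 ⊠ N` to `1 ⊠ N'`
  have key : ∀ n : N, ∃ n' : N', Box.unit H n' = φ.toFun (Box.unit H n) := fun n => by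
    refine exists_unit_eq_of_freeCoaction hβ hf _ ((φ.comm (Box.unit H n)).trans ?_)
    exact congrArg _ (freeCoaction_unit n)
  choose f hφ using key
  let g : N →ₗ[Env k A] N' :=
    { toFun := f
      map_add' := fun n n' => hf.unit_injective (by
        rw [map_add (Box.unit H), hφ, hφ, hφ, map_add (Box.unit H)]
        exact map_add φ.toFun _ _)
      map_smul' := fun x n => hf.unit_injective (by
        rw [RingHom.id_apply, map_smul (Box.unit H), hφ, hφ, map_smul (Box.unit H)]
        exact map_smul (φ.toFun.restrictScalars (Env k A)) x _) }
  refine ⟨ModuleCat.ofHom g, HopfMod.Hom.ext (LinearMap.ext fun t => ?_)⟩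
  induction t using Box.induction with
  | h b n =>
    change (Box.mk b (f n) : Box k A H N') = φ.toFun (Box.mk b n)
    rw [Box.mk_eq_smul_unit, Box.mk_eq_smul_unit, hφ]
    exact (φ.toFun.map_smul b _).symm
  | ha x y hx hy => exact (map_add _ x y).trans ((congrArg₂ _ hx hy).trans (map_add _ x y).symm)

theorem freeHopfMod_isEquivalence (hβ : Function.Bijective (galoisβ k A H))
    (hf : IsFaithfullyFlat k A H) : (freeHopfMod k A H).IsEquivalence where
  faithful := ⟨fun hfg => ModuleCat.hom_ext (LinearMap.ext fun n =>
    hf.unit_injective (LinearMap.congr_fun (congrArg HopfMod.Hom.toFun hfg) (Box.unit H n)))⟩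
  full := freeHopfMod_full hβ hf
  essSurj := ⟨fun M => ⟨ModuleCat.of _ (M.coinvariants hβ),
    ⟨HopfMod.isoOfBijective
      (M := (freeHopfMod k A H).obj (ModuleCat.of _ (M.coinvariants hβ)))
      ⟨M.counitMap hβ, M.δ_counitMap hβ⟩ (M.counitMap_bijective hβ hf)⟩⟩⟩

end Equivalences

end HopfAlgebroids

theorem mainTheorem11 {k A H : Type u} [Field k] [Ring A] [Algebra k A] [Ring H] [Algebra k H]
    [HopfAlgebroids.EnvRing k A H] [HopfAlgebroids.Coring k A H]
    [HopfAlgebroids.IsBialgebroid k A H] :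
    (HopfAlgebroids.toBimonadHopfMod k A H).IsEquivalence ∧
    Nonempty (HopfAlgebroids.freeHopfMod k A H ⋙ HopfAlgebroids.toBimonadHopfMod k A H ≅
      HopfAlgebroids.freeBimonadHopfMod k A H) ∧
    (HopfAlgebroids.IsHopfAlgebroid k A H → HopfAlgebroids.IsFaithfullyFlat k A H →
      (HopfAlgebroids.freeBimonadHopfMod k A H).IsEquivalence ∧
      (HopfAlgebroids.freeHopfMod k A H).IsEquivalence) := by
  have h₁ := HopfAlgebroids.toBimonadHopfMod_isEquivalence (k := k) (A := A) (H := H)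
  refine ⟨h₁, ⟨HopfAlgebroids.freeCompIso⟩, fun hH hf => ?_⟩
  have h₂ := HopfAlgebroids.freeHopfMod_isEquivalence hH.bijective_β hf
  exact ⟨Functor.isEquivalence_of_iso HopfAlgebroids.freeCompIso, h₂⟩
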